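/- **Theorem (semi-global and global early stopping, dependent splitting).** Let $n,d\ge 1$, let $X_1,\dots,X_n$ be random design points in $\mathbb R^d$ that are almost surely distinct, and let $Y_i=f(X_i)+\varepsilon_i$, $i=1,\dots,n$, with $f:\mathbb R^d\to\mathbb R$ measurable. For $v,w\in\mathbb R^n$ put $\langle v,w\rangle_n=\frac1n\sum_{i=1}^n v_iw_i$ and $\|v\|_n^2=\langle v,v\rangle_n$; a function $g$ on $\mathbb R^d$ is identified with $(g(X_i))_{i\le n}$. Assume that, for some $\bar\sigma\ge 0$, the noise vector is $\bar\sigma$-subgaussian given the design: for every $\lambda\in\mathbb R^n$, $$\mathbb E\big[e^{\langle\lambda,\varepsilon\rangle_n}\,\big|\,X_1,\dots,X_n\big]\le \exp\Big(\frac{\|\lambda\|_n^2\bar\sigma^2}{2n}\Big)\quad\text{a.s.}$$ *Trees.* For a node $A\subseteq\mathbb R^d$ let $n_A=\#\{i:X_i\in A\}$, let $\bar Y_A$ be the mean of the $Y_i$ with $X_i\in A$, and $R^2(A)=\frac1{n_A}\sum_{i:X_i\in A}(Y_i-\bar Y_A)^2$. A split $(j,c)$ of $A$ into $A_L=\{x\in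 A:x_j<c\}$ and $A_R=\{x\in A:x_j\ge c\}$ is admissible if both children contain a design point. A CART split of $A$ is an admissible split maximising $L_A(j,c)=R^2(A)-\frac{n_{A_L}}{n_A}R^2(A_L)-\frac{n_{A_R}}{n_A}R^2(A_R)$ over all admissible splits, and $\mathbb{IG}(A)$ denotes the maximal value. Start with the partition $P_1=\{\mathbb R^d\}$. In *semi-global* (best-first) growth, $P_{g+1}$ arises from $P_g$ by a CART split of one node $A$ with $n_A>1$ that has the largest $\mathbb{IG}(A)$ among such nodes; in *global* (breadth-first) growth, $P_{g+1}$ arises from $P_g$ by a CART split of every node with $n_A>1$, the other nodes being kept. Growth ends when every node contains exactly one design point. Ties may be broken in any (measurable) way. *Flow.* Let $k_0=0$, $\Pi_{k_0}=0$ and, for $g\ge 1$, let $k_g$ be the number of nodes of $P_g$ and let $\Pi_{k_g}$ be the orthogonal projection of $\mathbb R^n$ that replaces $v_i$ by the average of the $v_{i'}$ over all $X_{i'}$ in the node of $P_g$ containing $X_i$. For $t\in[0,n)$ put $g(t)=\max\{g:k_g\le t\}$ and $$\Pi_t=(1-\alpha)\Pi_{k_{g(t)}}+\alpha\,\Pi_{k_{g(t)+1}},\qquad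 \alpha=\frac{t-k_{g(t)}}{k_{g(t)+1}-k_{g(t)}},$$ and let $\Pi_n=\mathrm{Id}$. Put $\hat F_t=\Pi_tY$. For an integrable, possibly random, threshold $\kappa\ge 0$ let $$\tau=\inf\{t\in[0,n]:\|Y-\hat F_t\|_n^2\le\kappa\},\qquad \tau_b=\inf\{t\in[0,n]:\|(\mathrm{Id}-\Pi_t)f\|_n\le\|\Pi_t\varepsilon\|_n\}.$$ Then, both for semi-global and for global growth, $\|\hat F_\tau-f\|_n^2$ is integrable and $$\mathbb E\big[\|\hat F_\tau-f\|_n^2\big]\le 9\,\mathbb E\Big[\inf_{t\in[0,n]}\big(\|(\mathrm{Id}-\Pi_t)f\|_n^2+\|\Pi_t\varepsilon\|_n^2\big)\Big]+2\,\mathbb E\big[|\kappa-\|\varepsilon\|_n^2|\big]+24\,\frac{\bar\sigma^2\log((d\vee2)n)}{n}\,\mathbb E[\tau_b+1].$$ -/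

import Mathlib

open MeasureTheory

namespace TreeStopping

/-! ### Empirical geometry: `L²_n` is identified with `Fin n → ℝ` through the design points -/

/-- The empirical scalar product `⟨v, w⟩_n = n⁻¹ ∑ v_i w_i`. -/
noncomputable def empInner {n : ℕ} (v w : Fin n → ℝ) : ℝ := (∑ i, v i * w i) / n

/-- The empirical norm `‖v‖_n`. -/
noncomputable def empNorm {n : ℕ} (v : Fin n → ℝ) : ℝ := Real.sqrt (empInner v v)

/-! ### CART splits.  Nodes are subsets of `ℝ^d` -/

/-- The indices of the design points lying in the node `A`. -/
noncomputable def nodeIdx {n d : ℕ} (x : Fin n → Fin d → ℝ) (A : Set (Fin d → ℝ)) :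
    Finset (Fin n) :=
  open Classical in Finset.univ.filter (fun i => x i ∈ A)

/-- The local sample size `n_A`. -/
noncomputable def nodeSize {n d : ℕ} (x : Fin n → Fin d → ℝ) (A : Set (Fin d → ℝ)) : ℕ :=
  (nodeIdx x A).card

/-- The node average of `v` over the design points in `A`. -/
noncomputable def nodeMean {n d : ℕ} (x : Fin n → Fin d → ℝ) (v : Fin n → ℝ)
    (A : Set (Fin d → ℝ)) : ℝ :=
  (∑ i ∈ nodeIdx x A, v i) / nodeSize x A

/-- The impurity `R²(A)`: average squared residual in the node. -/
noncomputable def impurity {n d : ℕ} (x : Fin n → Fin d → ℝ) (y : Fin n → ℝ)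
    (A : Set (Fin d → ℝ)) : ℝ :=
  (∑ i ∈ nodeIdx x A, (y i - nodeMean x y A) ^ 2) / nodeSize x A

/-- The left child `{z ∈ A : z_j < c}`. -/
def leftChild {d : ℕ} (A : Set (Fin d → ℝ)) (j : Fin d) (c : ℝ) : Set (Fin d → ℝ) :=
  {z | z ∈ A ∧ z j < c}

/-- The right child `{z ∈ A : z_j ≥ c}`. -/
def rightChild {d : ℕ} (A : Set (Fin d → ℝ)) (j : Fin d) (c : ℝ) : Set (Fin d → ℝ) :=
  {z | z ∈ A ∧ c ≤ z j}

/-- A split is admissible if both children contain at least one design point. -/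
def AdmissibleSplit {n d : ℕ} (x : Fin n → Fin d → ℝ) (A : Set (Fin d → ℝ))
    (j : Fin d) (c : ℝ) : Prop :=
  1 ≤ nodeSize x (leftChild A j c) ∧ 1 ≤ nodeSize x (rightChild A j c)

/-- The impurity gain `L_A(j, c)`. -/
noncomputable def impurityGain {n d : ℕ} (x : Fin n → Fin d → ℝ) (y : Fin n → ℝ)
    (A : Set (Fin d → ℝ)) (j : Fin d) (c : ℝ) : ℝ :=
  impurity x y A
    - (nodeSize x (leftChild A j c) : ℝ) / nodeSize x A * impurity x y (leftChild A j c)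
    - (nodeSize x (rightChild A j c) : ℝ) / nodeSize x A * impurity x y (rightChild A j c)

/-- The maximal impurity gain of the node `A` over its admissible splits. -/
noncomputable def maxGain {n d : ℕ} (x : Fin n → Fin d → ℝ) (y : Fin n → ℝ)
    (A : Set (Fin d → ℝ)) : ℝ :=
  sSup {r : ℝ | ∃ j c, AdmissibleSplit x A j c ∧ r = impurityGain x y A j c}

/-- `(j, c)` is an admissible split of `A` that maximises the impurity gain. -/
def IsCARTSplit {n d : ℕ} (x : Fin n → Fin d → ℝ) (y : Fin n → ℝ)
    (A : Set (Fin d → ℝ)) (j : Fin d) (c : ℝ) : Prop :=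
  AdmissibleSplit x A j c ∧
    ∀ j' c', AdmissibleSplit x A j' c' → impurityGain x y A j' c' ≤ impurityGain x y A j c

/-! ### Tree growth -/

/-- One step of best-first growth: among the nodes with more than one design point, one with
maximal gain is split by the CART rule.  If there is no such node, nothing happens. -/
def BestFirstStep {n d : ℕ} (x : Fin n → Fin d → ℝ) (y : Fin n → ℝ)
    (P P' : Set (Set (Fin d → ℝ))) : Prop :=
  (∃ A ∈ P, 1 < nodeSize x A ∧ (∀ B ∈ P, 1 < nodeSize x B → maxGain x y B ≤ maxGain x y A) ∧
    ∃ j c, IsCARTSplit x y A j c ∧ P' = (P \ {A}) ∪ {leftChild A j c, rightChild A j c}) ∨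
  ((∀ A ∈ P, nodeSize x A ≤ 1) ∧ P' = P)

/-- One step of breadth-first growth: every node with more than one design point is split by the
CART rule and every other node is kept. -/
def BreadthFirstStep {n d : ℕ} (x : Fin n → Fin d → ℝ) (y : Fin n → ℝ)
    (P P' : Set (Set (Fin d → ℝ))) : Prop :=
  ∃ (j : Set (Fin d → ℝ) → Fin d) (c : Set (Fin d → ℝ) → ℝ),
    (∀ A ∈ P, 1 < nodeSize x A → IsCARTSplit x y A (j A) (c A)) ∧
    P' = {B | ∃ A ∈ P, (nodeSize x A ≤ 1 ∧ B = A) ∨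
      (1 < nodeSize x A ∧ (B = leftChild A (j A) (c A) ∨ B = rightChild A (j A) (c A)))}

/-- The two growth orders: semi-global (best-first) and global (breadth-first). -/
inductive GrowthRule where
  | semiGlobal
  | global

/-- The growth step belonging to a growth order. -/
def GrowthRule.Step (rule : GrowthRule) {n d : ℕ} (x : Fin n → Fin d → ℝ) (y : Fin n → ℝ)
    (P P' : Set (Set (Fin d → ℝ))) : Prop :=
  match rule with
  | .semiGlobal => BestFirstStep x y P P'
  | .global => BreadthFirstStep x y P P'

/-- `P 1, P 2, …` are the partitions produced by growing a CART tree on the data `(x, y)` from the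
root node `ℝ^d` (constant once all nodes contain one design point); ties are broken arbitrarily.
The entry `P 0 = ∅` encodes `k_0 = 0`, `V_{k_0} = {0}`. -/
def IsGrownTree (rule : GrowthRule) {n d : ℕ} (x : Fin n → Fin d → ℝ) (y : Fin n → ℝ)
    (P : ℕ → Set (Set (Fin d → ℝ))) : Prop :=
  P 0 = ∅ ∧ P 1 = {Set.univ} ∧ ∀ g, 1 ≤ g → rule.Step x y (P g) (P (g + 1))

/-! ### The interpolated projection flow -/

/-- Two design points lie in a common node of `P`. -/
def SameNode {d : ℕ} (P : Set (Set (Fin d → ℝ))) (z z' : Fin d → ℝ) : Prop :=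
  ∃ A ∈ P, z ∈ A ∧ z' ∈ A

/-- The orthogonal projection `Π_P`: averaging over the nodes of the partition `P`
(it is `0` for `P = ∅`). -/
noncomputable def nodeProj {n d : ℕ} (x : Fin n → Fin d → ℝ) (P : Set (Set (Fin d → ℝ)))
    (v : Fin n → ℝ) : Fin n → ℝ :=
  fun i => open Classical in
    (∑ i' ∈ Finset.univ.filter (fun i' => SameNode P (x i) (x i')), v i') /
      ((Finset.univ.filter (fun i' => SameNode P (x i) (x i'))).card : ℝ)

/-- `g(t) = max {g : k_g ≤ t}`, where `k_g` is the number of nodes of `P g` (used for `t < n`). -/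
noncomputable def genAt {d : ℕ} (P : ℕ → Set (Set (Fin d → ℝ))) (t : ℝ) : ℕ :=
  sSup {g : ℕ | ((P g).ncard : ℝ) ≤ t}

/-- The interpolation weight `α = (t - k_{g(t)}) / (k_{g(t)+1} - k_{g(t)})`. -/
noncomputable def weightAt {d : ℕ} (P : ℕ → Set (Set (Fin d → ℝ))) (t : ℝ) : ℝ :=
  (t - (P (genAt P t)).ncard) / (((P (genAt P t + 1)).ncard : ℝ) - (P (genAt P t)).ncard)

/-- The linearly interpolated projections `Π_t`, `t ∈ [0, n]`, with `Π_n = Id`. -/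
noncomputable def flow {n d : ℕ} (x : Fin n → Fin d → ℝ) (P : ℕ → Set (Set (Fin d → ℝ)))
    (t : ℝ) (v : Fin n → ℝ) : Fin n → ℝ :=
  open Classical in
  if t < n then
    (1 - weightAt P t) • nodeProj x (P (genAt P t)) v
      + weightAt P t • nodeProj x (P (genAt P t + 1)) v
  else v

/-! ### Stopping -/

/-- The balanced oracle `τ_b`, for the vectors `F` of function values and `e` of noise values. -/
noncomputable def balancedOracle {n d : ℕ} (x : Fin n → Fin d → ℝ)
    (P : ℕ → Set (Set (Fin d → ℝ))) (F e : Fin n → ℝ) : ℝ :=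
  sInf {t : ℝ | t ∈ Set.Icc (0 : ℝ) n ∧ empNorm (F - flow x P t F) ≤ empNorm (flow x P t e)}

/-- The early stopping rule `τ = inf {t ∈ [0, n] : R_t² ≤ κ}` with `R_t² = ‖Y - Π_t Y‖_n²`. -/
noncomputable def stopTime {n d : ℕ} (x : Fin n → Fin d → ℝ)
    (P : ℕ → Set (Set (Fin d → ℝ))) (y : Fin n → ℝ) (κ : ℝ) : ℝ :=
  sInf {t : ℝ | t ∈ Set.Icc (0 : ℝ) n ∧ empNorm (y - flow x P t y) ^ 2 ≤ κ}

/-- The early stopping estimator at the design points, `Π_τ Y`. -/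
noncomputable def stoppedFit {n d : ℕ} (x : Fin n → Fin d → ℝ)
    (P : ℕ → Set (Set (Fin d → ℝ))) (y : Fin n → ℝ) (κ : ℝ) : Fin n → ℝ :=
  flow x P (stopTime x P y κ) y

/-- The oracle error `inf_{t ∈ [0, n]} (‖(Id - Π_t) F‖_n² + ‖Π_t e‖_n²)`. -/
noncomputable def oracleError {n d : ℕ} (x : Fin n → Fin d → ℝ)
    (P : ℕ → Set (Set (Fin d → ℝ))) (F e : Fin n → ℝ) : ℝ :=
  ⨅ t : Set.Icc (0 : ℝ) n, (empNorm (F - flow x P t F) ^ 2 + empNorm (flow x P t e) ^ 2)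

/-! ### Noise -/

/-- The noise vector is `s`-subgaussian given the design:
`E[exp ⟨l, ε⟩_n | X_1, …, X_n] ≤ exp (‖l‖_n² s² / (2 n))` a.s., for every `l ∈ ℝⁿ`
(with integrability, so that the conditional expectation is meaningful). -/
def SubgaussianNoise {Ω : Type*} [MeasurableSpace Ω] (μ : Measure Ω) {n d : ℕ}
    (X : Ω → Fin n → Fin d → ℝ) (ε : Ω → Fin n → ℝ) (s : ℝ) : Prop :=
  ∀ l : Fin n → ℝ,
    Integrable (fun ω => Real.exp (empInner l (ε ω))) μ ∧
    ∀ᵐ ω ∂μ, (μ[fun ω => Real.exp (empInner l (ε ω)) | MeasurableSpace.comap X inferInstance]) ω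
      ≤ Real.exp (empNorm l ^ 2 * s ^ 2 / (2 * n))

end TreeStopping

/-! Averaging over successively refined partitions gives nested orthogonal projections, so bias,
stochastic error and residual are sums over orthogonal increments, with coefficients that are
continuous and monotone in `t`. In particular `‖(Π_τ - Π_b)Y‖²` is at most the difference of the two
squared residuals. Take `b` to be the balanced time. There bias and stochastic error have a common
value `x`, and `x` is at most the oracle error, because one curve falls and the other rises
(`balanced_le_oracleError`). By balance, the residual at `b` differs from `‖ε‖²` only by cross terms
`⟨ε, f - Π_g f⟩` at the two generations around `b` and by an interpolation term. Young's inequality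
charges `5x` for these; together with `4x` from the loss at `b` this gives the factor 9
(`IsChain.loss_le`).

It remains to control the noise in the range of `Π_g` and in the direction `f - Π_g f`, jointly
`extProj`. The tree depends on the noise, so the bound must be uniform over trees. Given the design,
the relation "same node" after `m` splits is determined by `m` pairs of a coordinate and a design
point (`Reach.exists_decode`), which leaves at most `(dn)^m` candidates, none depending on the
noise. For a fixed candidate, mixing the linear subgaussian bound over Gaussian coefficients gives
`E exp(extProj / (4s²)) ≤ √2^(m+2)`. With `L = log((d ∨ 2)n)`, adding all candidates with weights
`exp(-3L(m+1)/2)` gives `devSum`, whose mean is at most `4L`.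

Hence `extProj ≤ 6Ls²k + 2s² devSum` simultaneously for all generations. The deterministic bound
uses the slope four times and the intercept three times; the result is `24 s²L` times `τ_b` and, in
expectation, another `24 s²L`, which together make the term with `τ_b + 1`. The Gaussian mixing
needs `s > 0`; the case `s = 0` follows by letting the constant decrease to `s`. -/

namespace TreeStopping

/-! ### Averaging over the classes of a relation -/

/-- The indices related to `i`. -/
noncomputable def cls {n : ℕ} (r : Fin n → Fin n → Prop) (i : Fin n) : Finset (Fin n) :=
  open Classical in Finset.univ.filter (fun i' => r i i')

/-- The linear map averaging a vector over the classes of a relation. -/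
noncomputable def avg {n : ℕ} (r : Fin n → Fin n → Prop) : (Fin n → ℝ) →ₗ[ℝ] (Fin n → ℝ) where
  toFun v i := (∑ i' ∈ cls r i, v i') / ((cls r i).card : ℝ)
  map_add' v w := by
    funext i
    simp [Finset.sum_add_distrib, add_div]
  map_smul' c v := by
    funext i
    simp [← Finset.mul_sum, mul_div_assoc]

lemma avg_apply {n : ℕ} (r : Fin n → Fin n → Prop) (v : Fin n → ℝ) (i : Fin n) :
    avg r v i = (∑ i' ∈ cls r i, v i') / ((cls r i).card : ℝ) := rfl

lemma mem_cls {n : ℕ} {r : Fin n → Fin n → Prop} {i i' : Fin n} : i' ∈ cls r i ↔ r i i' := by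
  simp [cls]

lemma cls_eq_of_rel {n : ℕ} {r : Fin n → Fin n → Prop} (hr : Equivalence r) {i i' : Fin n}
    (h : r i i') : cls r i = cls r i' := by
  ext l
  rw [mem_cls, mem_cls]
  exact ⟨fun h' => hr.trans (hr.symm h) h', fun h' => hr.trans h h'⟩

lemma card_cls_pos {n : ℕ} {r : Fin n → Fin n → Prop} (hr : Equivalence r) (i : Fin n) :
    0 < (cls r i).card :=
  Finset.card_pos.2 ⟨i, mem_cls.2 (hr.refl i)⟩

/-- The averaging kernel is the indicator of the relation divided by the class size, and related
indices have the same class. -/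
lemma avg_symm {n : ℕ} {r : Fin n → Fin n → Prop} (hr : Equivalence r) (v w : Fin n → ℝ) :
    avg r v ⬝ᵥ w = v ⬝ᵥ avg r w := by
  classical
  have key : ∀ v w : Fin n → ℝ, avg r v ⬝ᵥ w =
      ∑ i, ∑ i', if r i i' then v i' * w i / ((cls r i).card : ℝ) else 0 := by
    intro v w
    simp only [dotProduct, avg_apply]
    refine Finset.sum_congr rfl fun i _ => ?_
    rw [div_mul_eq_mul_div, Finset.sum_mul, Finset.sum_div, cls, Finset.sum_filter]
  rw [key v w, dotProduct_comm v, key w v, Finset.sum_comm]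
  refine Finset.sum_congr rfl fun i _ => Finset.sum_congr rfl fun i' _ => ?_
  by_cases h : r i i'
  · rw [if_pos h, if_pos (hr.symm h), cls_eq_of_rel hr h, mul_comm]
  · rw [if_neg h, if_neg (fun h' => h (hr.symm h'))]

lemma avg_avg_of_le {n : ℕ} {r r' : Fin n → Fin n → Prop} (hr : Equivalence r)
    (hr' : Equivalence r') (h : ∀ i i', r' i i' → r i i') (v : Fin n → ℝ) :
    avg r' (avg r v) = avg r v := by
  funext i
  have hc : ∀ i' ∈ cls r' i, avg r v i' = avg r v i := by
    intro i' hi'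
    rw [avg_apply, avg_apply, cls_eq_of_rel hr (h _ _ (mem_cls.1 hi'))]
  rw [avg_apply, Finset.sum_congr rfl hc, Finset.sum_const, nsmul_eq_mul]
  have := card_cls_pos hr' i
  field_simp

lemma avg_eq_id {n : ℕ} {r : Fin n → Fin n → Prop} (h : ∀ i i', r i i' ↔ i = i') :
    avg r = LinearMap.id := by
  have h1 : r = fun i i' => i = i' := by
    funext i i'
    exact propext (h i i')
  refine LinearMap.ext fun v => funext fun i' => ?_
  simp [avg_apply, cls, h1, Finset.filter_eq]

lemma avg_eq_zero {n : ℕ} {r : Fin n → Fin n → Prop} (h : ∀ i i', ¬ r i i') : avg r = 0 := by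
  refine LinearMap.ext fun v => funext fun i' => ?_
  simp [avg_apply, cls, h]

/-! ### Nested families of orthogonal projections and their interpolation -/

/-- A nested family of orthogonal projections `p g` with strictly increasing dimension counts `k g`,
starting from `0` and ending with the identity. -/
structure IsChain {n : ℕ} (p : ℕ → (Fin n → ℝ) →ₗ[ℝ] (Fin n → ℝ)) (k : ℕ → ℕ) : Prop where
  symm : ∀ g v w, p g v ⬝ᵥ w = v ⬝ᵥ p g w
  nest : ∀ g h, g ≤ h → ∀ v, p h (p g v) = p g v
  zero : p 0 = 0
  k_zero : k 0 = 0
  k_le : ∀ g, k g ≤ n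
  k_lt : ∀ g, k g < n → k g < k (g + 1)
  k_stop : ∀ g, k g = n → k (g + 1) = n
  full : ∀ g, k g = n → p g = LinearMap.id

/-- The increments `p (g + 1) - p g`. -/
noncomputable def incr {n : ℕ} (p : ℕ → (Fin n → ℝ) →ₗ[ℝ] (Fin n → ℝ)) (g : ℕ) :
    (Fin n → ℝ) →ₗ[ℝ] (Fin n → ℝ) := p (g + 1) - p g

/-- The piecewise linear weight of the `g`-th increment at time `t`. -/
noncomputable def wt (k : ℕ → ℕ) (g : ℕ) (t : ℝ) : ℝ :=
  max 0 (min 1 ((t - k g) / ((k (g + 1) : ℝ) - k g)))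

/-- The linear combination of the increments with weights `a`. -/
noncomputable def comb {n : ℕ} (p : ℕ → (Fin n → ℝ) →ₗ[ℝ] (Fin n → ℝ)) (a : ℕ → ℝ)
    (v : Fin n → ℝ) : Fin n → ℝ := ∑ g ∈ Finset.range n, a g • incr p g v

/-- The contribution of the `g`-th increment to the scalar product. -/
noncomputable def comp {n : ℕ} (p : ℕ → (Fin n → ℝ) →ₗ[ℝ] (Fin n → ℝ)) (g : ℕ)
    (v w : Fin n → ℝ) : ℝ := incr p g v ⬝ᵥ incr p g w

namespace IsChain

variable {n : ℕ} {p : ℕ → (Fin n → ℝ) →ₗ[ℝ] (Fin n → ℝ)} {k : ℕ → ℕ}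

lemma dot_nest (hc : IsChain p k) {g h : ℕ} (hgh : g ≤ h) (v w : Fin n → ℝ) :
    p g v ⬝ᵥ p h w = p g v ⬝ᵥ w := by
  rw [← hc.symm, hc.nest g h hgh]

lemma dot_nest' (hc : IsChain p k) {g h : ℕ} (hgh : g ≤ h) (v w : Fin n → ℝ) :
    p h v ⬝ᵥ p g w = p g v ⬝ᵥ w := by
  rw [hc.symm, hc.nest g h hgh, hc.symm]

lemma incr_orth_lt (hc : IsChain p k) {g h : ℕ} (hgh : g < h) (v w : Fin n → ℝ) :
    incr p g v ⬝ᵥ incr p h w = 0 := by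
  simp only [incr, LinearMap.sub_apply, dotProduct_sub, sub_dotProduct]
  rw [hc.dot_nest (by omega), hc.dot_nest (by omega), hc.dot_nest (by omega),
    hc.dot_nest (by omega)]
  ring

lemma incr_orth (hc : IsChain p k) {g h : ℕ} (hgh : g ≠ h) (v w : Fin n → ℝ) :
    incr p g v ⬝ᵥ incr p h w = 0 := by
  rcases lt_or_gt_of_ne hgh with h1 | h1
  · exact hc.incr_orth_lt h1 v w
  · rw [dotProduct_comm]
    exact hc.incr_orth_lt h1 w v

lemma comp_eq (hc : IsChain p k) (g : ℕ) (v w : Fin n → ℝ) :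
    comp p g v w = p (g + 1) v ⬝ᵥ w - p g v ⬝ᵥ w := by
  simp only [comp, incr, LinearMap.sub_apply, dotProduct_sub, sub_dotProduct]
  rw [hc.dot_nest le_rfl, hc.dot_nest' (Nat.le_succ g), hc.dot_nest (Nat.le_succ g),
    hc.dot_nest le_rfl]
  ring

lemma comp_nonneg (p : ℕ → (Fin n → ℝ) →ₗ[ℝ] (Fin n → ℝ)) (g : ℕ) (v : Fin n → ℝ) :
    0 ≤ comp p g v v := by
  unfold comp dotProduct
  exact Finset.sum_nonneg fun i _ => mul_self_nonneg (incr p g v i)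

lemma comb_dot (hc : IsChain p k) (a b : ℕ → ℝ) (v w : Fin n → ℝ) :
    comb p a v ⬝ᵥ comb p b w = ∑ g ∈ Finset.range n, a g * b g * comp p g v w := by
  simp only [comb, sum_dotProduct, dotProduct_sum]
  refine Finset.sum_congr rfl fun g hg => ?_
  rw [Finset.sum_eq_single g]
  · simp only [comp, smul_dotProduct, dotProduct_smul, smul_eq_mul]
    ring
  · intro h _ hh
    simp [hc.incr_orth hh]
  · exact fun h => absurd hg h

/-- Dimensions grow by at least one per generation until they reach `n`. Hence generation `n` is
complete, and sums over the first `n` increments suffice. -/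
lemma k_ge (hc : IsChain p k) (g : ℕ) : min g n ≤ k g := by
  induction g with
  | zero => simp
  | succ g ih =>
    rcases (hc.k_le g).lt_or_eq with h | h
    · have := hc.k_lt g h
      omega
    · have := hc.k_stop g h
      omega

lemma k_last (hc : IsChain p k) : k n = n :=
  le_antisymm (hc.k_le n) (by simpa using hc.k_ge n)

lemma k_mono (hc : IsChain p k) : Monotone k := by
  refine monotone_nat_of_le_succ fun g => ?_
  rcases (hc.k_le g).lt_or_eq with h | h
  · exact (hc.k_lt g h).le
  · rw [hc.k_stop g h, h]

lemma sum_incr (hc : IsChain p k) (g : ℕ) (v : Fin n → ℝ) :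
    ∑ h ∈ Finset.range g, incr p h v = p g v := by
  have := Finset.sum_range_sub (fun h => p h v) g
  simp only [hc.zero, LinearMap.zero_apply, sub_zero] at this
  rw [← this]
  rfl

lemma comb_one (hc : IsChain p k) (v : Fin n → ℝ) : comb p (fun _ => 1) v = v := by
  simp only [comb, one_smul]
  rw [hc.sum_incr, hc.full n hc.k_last]
  rfl

end IsChain

lemma comb_sub {n : ℕ} (p : ℕ → (Fin n → ℝ) →ₗ[ℝ] (Fin n → ℝ)) (a b : ℕ → ℝ) (v : Fin n → ℝ) :
    comb p a v - comb p b v = comb p (fun g => a g - b g) v := by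
  simp [comb, sub_smul, Finset.sum_sub_distrib]

lemma comb_add_vec {n : ℕ} (p : ℕ → (Fin n → ℝ) →ₗ[ℝ] (Fin n → ℝ)) (a : ℕ → ℝ)
    (v w : Fin n → ℝ) : comb p a (v + w) = comb p a v + comb p a w := by
  simp [comb, Finset.sum_add_distrib]

lemma wt_nonneg (k : ℕ → ℕ) (g : ℕ) (t : ℝ) : 0 ≤ wt k g t := le_max_left _ _

lemma wt_le_one (k : ℕ → ℕ) (g : ℕ) (t : ℝ) : wt k g t ≤ 1 :=
  max_le zero_le_one (min_le_left _ _)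

lemma continuous_wt (k : ℕ → ℕ) (g : ℕ) : Continuous (wt k g) := by
  unfold wt
  fun_prop

namespace IsChain

variable {n : ℕ} {p : ℕ → (Fin n → ℝ) →ₗ[ℝ] (Fin n → ℝ)} {k : ℕ → ℕ}

lemma wt_mono (hc : IsChain p k) (g : ℕ) : Monotone (wt k g) := by
  intro s t hst
  have : (k g : ℝ) ≤ k (g + 1) := by exact_mod_cast hc.k_mono (Nat.le_succ g)
  unfold wt
  gcongr

lemma exists_between (hc : IsChain p k) {t : ℝ} (ht0 : 0 ≤ t) (htn : t < n) :
    ∃ G, G < n ∧ (k G : ℝ) ≤ t ∧ t < k (G + 1) := by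
  classical
  have hex : ∃ g, t < k (g + 1) := by
    refine ⟨n - 1, ?_⟩
    have hn : 0 < n := by
      by_contra h
      have : n = 0 := by omega
      subst this
      simp at htn
      linarith
    rw [Nat.sub_add_cancel hn, hc.k_last]
    exact htn
  refine ⟨Nat.find hex, ?_, ?_, Nat.find_spec hex⟩
  · have hn : 0 < n := by
      by_contra h
      have : n = 0 := by omega
      subst this
      simp at htn
      linarith
    have : Nat.find hex ≤ n - 1 := by
      refine Nat.find_min' hex ?_
      rw [Nat.sub_add_cancel hn, hc.k_last]
      exact htn
    omega
  · rcases h : Nat.find hex with _ | m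
    · rw [hc.k_zero]
      simpa using ht0
    · exact not_lt.1 (Nat.find_min hex (m := m) (by omega))

lemma wt_of_between (hc : IsChain p k) {t : ℝ} {G : ℕ} (h1 : (k G : ℝ) ≤ t)
    (h2 : t ≤ k (G + 1)) (hlt : k G < k (G + 1)) :
    (∀ g, g < G → wt k g t = 1) ∧ wt k G t = (t - k G) / ((k (G + 1) : ℝ) - k G) ∧
      ∀ g, G < g → wt k g t = 0 := by
  have hlt' : (k G : ℝ) < k (G + 1) := by exact_mod_cast hlt
  refine ⟨fun g hg => ?_, ?_, fun g hg => ?_⟩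
  · have e1 : k g < k (g + 1) := by
      refine hc.k_lt g ?_
      have := hc.k_mono hg.le
      have := hc.k_le (G + 1)
      omega
    have e1' : (k g : ℝ) < k (g + 1) := by exact_mod_cast e1
    have e2 : (k (g + 1) : ℝ) ≤ k G := by exact_mod_cast hc.k_mono hg
    have : 1 ≤ (t - k g) / ((k (g + 1) : ℝ) - k g) := by
      rw [one_le_div (by linarith)]
      linarith
    simp [wt, this]
  · have e1 : 0 ≤ (t - k G) / ((k (G + 1) : ℝ) - k G) := div_nonneg (by linarith) (by linarith)
    have e2 : (t - k G) / ((k (G + 1) : ℝ) - k G) ≤ 1 := by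
      rw [div_le_one (by linarith)]
      linarith
    simp [wt, e1, e2]
  · have e1 : (k (G + 1) : ℝ) ≤ k g := by exact_mod_cast hc.k_mono hg
    have e2 : (k g : ℝ) ≤ k (g + 1) := by exact_mod_cast hc.k_mono (Nat.le_succ g)
    -- After completion the denominator is zero; the quotient is then 0 by convention, so the weight
    -- still vanishes.
    have : (t - k g) / ((k (g + 1) : ℝ) - k g) ≤ 0 :=
      div_nonpos_of_nonpos_of_nonneg (by linarith) (by linarith)
    refine max_eq_left ((min_le_right _ _).trans this)

/-- Every time in `[0, n]` lies in a proper segment on which the weights are explicit. -/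
lemma exists_segment (hc : IsChain p k) (hn : 1 ≤ n) {t : ℝ} (ht0 : 0 ≤ t) (htn : t ≤ n) :
    ∃ G α, G < n ∧ 0 ≤ α ∧ α ≤ 1 ∧ t = (1 - α) * k G + α * k (G + 1) ∧ k G < k (G + 1) ∧
      (∀ g, g < G → wt k g t = 1) ∧ wt k G t = α ∧ ∀ g, G < g → wt k g t = 0 := by
  have main : ∃ G, G < n ∧ (k G : ℝ) ≤ t ∧ t ≤ k (G + 1) ∧ k G < k (G + 1) := by
    rcases htn.lt_or_eq with h | h
    · obtain ⟨G, h0, h1, h2⟩ := hc.exists_between ht0 h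
      exact ⟨G, h0, h1, h2.le, by exact_mod_cast h1.trans_lt h2⟩
    · have hn' : ((n - 1 : ℕ) : ℝ) < n := by exact_mod_cast (show n - 1 < n by omega)
      obtain ⟨G, h0, h1, h2⟩ := hc.exists_between (Nat.cast_nonneg (n - 1)) hn'
      have h3 : k (G + 1) = n := by
        have : n - 1 < k (G + 1) := by exact_mod_cast h2
        have := hc.k_le (G + 1)
        omega
      refine ⟨G, h0, by linarith, ?_, by exact_mod_cast h1.trans_lt h2⟩
      rw [h3, h]
  obtain ⟨G, h0, h1, h2, h3⟩ := main
  obtain ⟨w1, w2, w3⟩ := hc.wt_of_between h1 h2 h3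
  have h3' : (k G : ℝ) < k (G + 1) := by exact_mod_cast h3
  refine ⟨G, _, h0, div_nonneg (by linarith) (by linarith), ?_, ?_, h3, w1, w2, w3⟩
  · rw [div_le_one (by linarith)]
    linarith
  · have : (k (G + 1) : ℝ) - k G ≠ 0 := by linarith
    field_simp
    ring

/-- Sums of increment contributions against weights of segment form. -/
lemma sum_segment {M : Type*} [AddCommGroup M] [Module ℝ M] {n G : ℕ} (hG : G < n) (a : ℕ → ℝ)
    (α β γ : ℝ) (h1 : ∀ g, g < G → a g = β) (h2 : a G = α) (h3 : ∀ g, G < g → a g = γ)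
    (c : ℕ → M) :
    ∑ g ∈ Finset.range n, a g • c g = β • ∑ g ∈ Finset.range G, c g + α • c G +
      γ • (∑ g ∈ Finset.range n, c g - ∑ g ∈ Finset.range (G + 1), c g) := by
  have e : ∀ b : ℕ → M, ∑ g ∈ Finset.range n, b g = ∑ g ∈ Finset.range (G + 1), b g +
      ∑ g ∈ Finset.Ico (G + 1) n, b g := fun b => (Finset.sum_range_add_sum_Ico b hG).symm
  rw [e (fun g => a g • c g), e c, add_sub_cancel_left, Finset.sum_range_succ,
    Finset.smul_sum, Finset.smul_sum, h2]
  congr 1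
  · congr 1
    exact Finset.sum_congr rfl fun g hg => by rw [h1 g (Finset.mem_range.1 hg)]
  · exact Finset.sum_congr rfl fun g hg => by rw [h3 g (Finset.mem_Ico.1 hg).1]

lemma comb_wt_segment (hc : IsChain p k) {t : ℝ} {G : ℕ} (hG : G < n)
    (h1 : ∀ g, g < G → wt k g t = 1) (h3 : ∀ g, G < g → wt k g t = 0) (v : Fin n → ℝ) :
    comb p (fun g => wt k g t) v = (1 - wt k G t) • p G v + wt k G t • p (G + 1) v := by
  rw [comb, sum_segment hG (fun g => wt k g t) _ 1 0 h1 rfl h3, hc.sum_incr, incr,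
    LinearMap.sub_apply]
  module

end IsChain

/-! ### First passage times of continuous decreasing functions -/

/-- The sublevel set is closed, so the infimum is attained; before it the function is positive, so
continuity forces the value 0 unless passage is immediate. The last clause expresses the event `c ≤
a` through the value at one fixed time, which later yields measurability of the random times. -/
lemma firstPassage {f : ℝ → ℝ} (hf : Continuous f) (hm : Antitone f) {b : ℝ} (hb : 0 ≤ b)
    (hfb : f b ≤ 0) {c : ℝ} (hc : c = sInf {t | t ∈ Set.Icc (0 : ℝ) b ∧ f t ≤ 0}) :
    c ∈ Set.Icc (0 : ℝ) b ∧ f c ≤ 0 ∧ (0 < c → f c = 0) ∧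
      ∀ a, 0 ≤ a → (c ≤ a ↔ f a ≤ 0) := by
  set S := {t | t ∈ Set.Icc (0 : ℝ) b ∧ f t ≤ 0} with hS
  have hbdd : BddBelow S := ⟨0, fun t ht => ht.1.1⟩
  have hne : S.Nonempty := ⟨b, ⟨hb, le_rfl⟩, hfb⟩
  have hcl : IsClosed S := isClosed_Icc.inter (isClosed_le hf continuous_const)
  have hmem : c ∈ S := hc ▸ hcl.csInf_mem hne hbdd
  refine ⟨hmem.1, hmem.2, fun h0 => le_antisymm hmem.2 ?_, fun a ha => ⟨fun h => ?_, fun h => ?_⟩⟩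
  · have h1 : ∀ t ∈ Set.Ioo 0 c, 0 ≤ f t := by
      intro t ht
      by_contra hneg
      have : c ≤ t := hc ▸ csInf_le hbdd
        ⟨⟨ht.1.le, ht.2.le.trans hmem.1.2⟩, (not_le.1 hneg).le⟩
      exact absurd ht.2 (not_lt.2 this)
    have h2 : c ∈ closure (Set.Ioo 0 c) := by
      rw [closure_Ioo h0.ne]
      exact ⟨h0.le, le_rfl⟩
    exact closure_minimal h1 (isClosed_le continuous_const hf) h2
  · exact (hm h).trans hmem.2
  · rcases le_total a b with hab | hab
    · exact hc ▸ csInf_le hbdd ⟨⟨ha, hab⟩, h⟩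
    · exact hmem.1.2.trans hab

/-! ### Elementary inequalities -/

/-- Young's inequality with weights 5 and 4/5, whose product is 4. The weight 5 is the part of the
final constant 9 that is spent on cross terms. -/
lemma four_mul_le_of_sq_le {A Z C u v w : ℝ} (hA : 0 ≤ A) (hZ : 0 ≤ Z) (hu : 0 ≤ u) (hv : 0 ≤ v)
    (hC : C ^ 2 ≤ A * Z) (hw : w ^ 2 ≤ u * v) : 4 * w * C ≤ 5 * u * A + 4 / 5 * v * Z := by
  refine abs_le_of_sq_le_sq' ?_ (by positivity) |>.2
  have h1 : w ^ 2 * C ^ 2 ≤ (u * v) * (A * Z) :=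
    mul_le_mul hw hC (sq_nonneg _) (mul_nonneg hu hv)
  nlinarith [sq_nonneg (5 * u * A - 4 / 5 * v * Z)]

/-- The case of stopping after the balanced time. `A, A'` are the biases at the two generations
around that time, `C, C'` the cross terms, `z, z'` their normalised squares, and `q` the noise
energy of the increment in between. -/
lemma upper_case {α k k' A A' z z' C C' a c q : ℝ} (h0 : 0 ≤ α) (h1 : α ≤ 1) (hk : 0 ≤ k)
    (hkk : k ≤ k') (hA : 0 ≤ A) (hA' : 0 ≤ A') (hz : 0 ≤ z) (hz' : 0 ≤ z') (ha : 0 ≤ a)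
    (hc : 0 ≤ c) (hq : 0 ≤ q) (hC : C ^ 2 ≤ A * z) (hC' : C' ^ 2 ≤ A' * z')
    (hm : z ≤ a * k + c) (hm' : q + z' ≤ a * k' + c) :
    4 * ((1 - α) * (1 - 2 * α)) * C + 4 * (α * (3 - 2 * α)) * C' - 4 * α * (1 - α) * q ≤
      5 * ((1 - α) ^ 2 * A + α * (2 - α) * A') + 4 * a * ((1 - α) * k + α * k') + 3 * c := by
  have e1 := four_mul_le_of_sq_le (u := (1 - α) ^ 2) (v := (1 - 2 * α) ^ 2)
    (w := (1 - α) * (1 - 2 * α)) hA hz (sq_nonneg _) (sq_nonneg _) hC (by rw [mul_pow])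
  have hv : 0 ≤ α * (9 / 2 - 7 / 2 * α) := mul_nonneg h0 (by linarith)
  have hu : 0 ≤ α * (2 - α) := mul_nonneg h0 (by linarith)
  -- The factor `9/2 - 7/2 α` is the chord over `[0, 1]` of the convex function `(3 - 2α)² / (2 -
  -- α)`.
  have e2 := four_mul_le_of_sq_le (u := α * (2 - α)) (v := α * (9 / 2 - 7 / 2 * α))
    (w := α * (3 - 2 * α)) hA' hz' hu hv hC' (by
      have : 0 ≤ α ^ 2 * (α * (1 - α)) :=
        mul_nonneg (sq_nonneg _) (mul_nonneg h0 (by linarith))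
      nlinarith)
  have e3 : 4 / 5 * (1 - 2 * α) ^ 2 * z ≤ 4 / 5 * (1 - 2 * α) ^ 2 * (a * k + c) := by gcongr
  have e4 : 4 / 5 * (α * (9 / 2 - 7 / 2 * α)) * z' ≤
      4 / 5 * (α * (9 / 2 - 7 / 2 * α)) * (a * k' + c) := by
    gcongr
    linarith
  have e5 : 0 ≤ 4 * α * (1 - α) * q := by
    have : 0 ≤ 1 - α := by linarith
    positivity
  have e6 : 4 / 5 * (1 - 2 * α) ^ 2 * (a * k) + 4 / 5 * (α * (9 / 2 - 7 / 2 * α)) * (a * k') ≤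
      4 * a * ((1 - α) * k + α * k') := by
    have : 4 / 5 * (1 - 2 * α) ^ 2 * k + 4 / 5 * (α * (9 / 2 - 7 / 2 * α)) * k' ≤
        4 * ((1 - α) * k + α * k') := by
      have t1 : 0 ≤ α * (2 / 5 + 14 / 5 * α) * (k' - k) :=
        mul_nonneg (by positivity) (by linarith)
      have t2 : 0 ≤ (16 / 5 - 2 / 5 * α - 2 / 5 * α ^ 2) * k :=
        mul_nonneg (by nlinarith) hk
      nlinarith
    nlinarith
  have e7 : 4 / 5 * (1 - 2 * α) ^ 2 * c + 4 / 5 * (α * (9 / 2 - 7 / 2 * α)) * c ≤ 3 * c := by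
    have : 4 / 5 * (1 - 2 * α) ^ 2 + 4 / 5 * (α * (9 / 2 - 7 / 2 * α)) ≤ 3 := by nlinarith
    nlinarith
  linarith

/-- The case of stopping no later than the balanced time. Here `q` enters with the unfavourable sign
and has to share the budget `q + z' ≤ a k' + c` with `z'`. -/
lemma lower_case {α k k' A A' z z' C C' a c q : ℝ} (h0 : 0 ≤ α) (h1 : α ≤ 1) (hk : 0 ≤ k)
    (hkk : k ≤ k') (hA : 0 ≤ A) (hA' : 0 ≤ A') (hz : 0 ≤ z) (hz' : 0 ≤ z') (ha : 0 ≤ a)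
    (hc : 0 ≤ c) (hq : 0 ≤ q) (hC : C ^ 2 ≤ A * z) (hC' : C' ^ 2 ≤ A' * z')
    (hm : z ≤ a * k + c) (hm' : q + z' ≤ a * k' + c) :
    4 * (-(1 - α)) * C + 4 * (-α) * C' + 4 * α * (1 - α) * q ≤
      5 * ((1 - α) ^ 2 * A + α * (2 - α) * A') + 4 * a * ((1 - α) * k + α * k') + 3 * c := by
  have e1 := four_mul_le_of_sq_le (u := (1 - α) ^ 2) (v := 1)
    (w := -(1 - α)) hA hz (sq_nonneg _) zero_le_one hC (by rw [neg_sq, mul_one])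
  have hu : 0 ≤ α * (2 - α) := mul_nonneg h0 (by linarith)
  have e2 := four_mul_le_of_sq_le (u := α * (2 - α)) (v := α)
    (w := -α) hA' hz' hu h0 hC' (by
      have : 0 ≤ α ^ 2 * (1 - α) := mul_nonneg (sq_nonneg _) (by linarith)
      nlinarith)
  -- The factor `4 - 16/5 α` interpolates between 4 and 4/5, so it dominates both `4(1 - α)` and
  -- `4/5`, the coefficients of `q` and `z'` after removing `α`.
  have hco : 0 ≤ α * (4 - 16 / 5 * α) := mul_nonneg h0 (by linarith)
  have e4 : 4 / 5 * α * z' + 4 * α * (1 - α) * q ≤ α * (4 - 16 / 5 * α) * (a * k' + c) := by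
    have t1 : 4 / 5 * α * z' ≤ α * (4 - 16 / 5 * α) * z' := by
      have : 4 / 5 * α ≤ α * (4 - 16 / 5 * α) := by nlinarith
      gcongr
    have t2 : 4 * α * (1 - α) * q ≤ α * (4 - 16 / 5 * α) * q := by
      have : 4 * α * (1 - α) ≤ α * (4 - 16 / 5 * α) := by nlinarith
      gcongr
    have t3 : α * (4 - 16 / 5 * α) * (q + z') ≤ α * (4 - 16 / 5 * α) * (a * k' + c) := by gcongr
    linarith
  have e6 : 4 / 5 * (a * k) + α * (4 - 16 / 5 * α) * (a * k') ≤
      4 * a * ((1 - α) * k + α * k') := by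
    have : 4 / 5 * k + α * (4 - 16 / 5 * α) * k' ≤ 4 * ((1 - α) * k + α * k') := by
      have t1 : 0 ≤ α ^ 2 * (16 / 5) * (k' - k) := mul_nonneg (by positivity) (by linarith)
      have t2 : 0 ≤ (16 / 5 - 4 * α + 16 / 5 * α ^ 2) * k :=
        mul_nonneg (by nlinarith [sq_nonneg (α - 5 / 8)]) hk
      nlinarith
    nlinarith
  have e7 : 4 / 5 * c + α * (4 - 16 / 5 * α) * c ≤ 3 * c := by
    have : 4 / 5 + α * (4 - 16 / 5 * α) ≤ 3 := by nlinarith [sq_nonneg (α - 5 / 8)]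
    nlinarith
  linarith

/-! ### The deterministic error bound -/

/-- The squared length of the projection of `e` onto the range of `q` and the direction
`v - q v`. -/
noncomputable def extProj {n : ℕ} (q : (Fin n → ℝ) →ₗ[ℝ] (Fin n → ℝ)) (v e : Fin n → ℝ) : ℝ :=
  e ⬝ᵥ q e + (e ⬝ᵥ (v - q v)) ^ 2 / ((v - q v) ⬝ᵥ (v - q v))

/-- The interpolated projections in terms of the increments. -/
noncomputable def spec {n : ℕ} (p : ℕ → (Fin n → ℝ) →ₗ[ℝ] (Fin n → ℝ)) (k : ℕ → ℕ) (t : ℝ)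
    (v : Fin n → ℝ) : Fin n → ℝ := comb p (fun g => wt k g t) v

lemma dot_self_nonneg {n : ℕ} (v : Fin n → ℝ) : 0 ≤ v ⬝ᵥ v := by
  unfold dotProduct
  exact Finset.sum_nonneg fun i _ => mul_self_nonneg (v i)

lemma dot_add_self_le {n : ℕ} (u v : Fin n → ℝ) :
    (u + v) ⬝ᵥ (u + v) ≤ 2 * (u ⬝ᵥ u) + 2 * (v ⬝ᵥ v) := by
  have := dot_self_nonneg (u - v)
  simp only [dotProduct_sub, sub_dotProduct, dotProduct_add, add_dotProduct] at *
  linarith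

lemma sq_le_mul_div {n : ℕ} (e v : Fin n → ℝ) :
    (e ⬝ᵥ v) ^ 2 ≤ (v ⬝ᵥ v) * ((e ⬝ᵥ v) ^ 2 / (v ⬝ᵥ v)) := by
  by_cases h : v ⬝ᵥ v = 0
  · rw [dotProduct_self_eq_zero.1 h]
    simp
  · rw [mul_div_cancel₀ _ h]

lemma comp_comm {n : ℕ} (p : ℕ → (Fin n → ℝ) →ₗ[ℝ] (Fin n → ℝ)) (g : ℕ) (v w : Fin n → ℝ) :
    comp p g v w = comp p g w v := dotProduct_comm _ _

lemma comp_add_self {n : ℕ} (p : ℕ → (Fin n → ℝ) →ₗ[ℝ] (Fin n → ℝ)) (g : ℕ) (v w : Fin n → ℝ) :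
    comp p g (v + w) (v + w) = comp p g v v + 2 * comp p g v w + comp p g w w := by
  simp only [comp, map_add, dotProduct_add, add_dotProduct]
  rw [dotProduct_comm (incr p g w) (incr p g v)]
  ring

namespace IsChain

variable {n : ℕ} {p : ℕ → (Fin n → ℝ) →ₗ[ℝ] (Fin n → ℝ)} {k : ℕ → ℕ}

lemma sub_spec (hc : IsChain p k) (t : ℝ) (v : Fin n → ℝ) :
    v - spec p k t v = comb p (fun g => 1 - wt k g t) v := by
  nth_rewrite 1 [← hc.comb_one v]
  rw [spec, comb_sub]

lemma spec_dot (hc : IsChain p k) (t : ℝ) (v : Fin n → ℝ) :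
    spec p k t v ⬝ᵥ spec p k t v = ∑ g ∈ Finset.range n, wt k g t ^ 2 * comp p g v v := by
  rw [spec, hc.comb_dot]
  simp only [sq]

lemma sub_spec_dot (hc : IsChain p k) (t : ℝ) (v : Fin n → ℝ) :
    (v - spec p k t v) ⬝ᵥ (v - spec p k t v) =
      ∑ g ∈ Finset.range n, (1 - wt k g t) ^ 2 * comp p g v v := by
  rw [hc.sub_spec, hc.comb_dot]
  simp only [sq]

lemma spec_dot_mono (hc : IsChain p k) (v : Fin n → ℝ) :
    Monotone fun t => spec p k t v ⬝ᵥ spec p k t v := by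
  intro s t hst
  simp only [hc.spec_dot]
  refine Finset.sum_le_sum fun g _ => ?_
  have := hc.wt_mono g hst
  have := wt_nonneg k g s
  have := comp_nonneg p g v
  gcongr

lemma sub_spec_dot_anti (hc : IsChain p k) (v : Fin n → ℝ) :
    Antitone fun t => (v - spec p k t v) ⬝ᵥ (v - spec p k t v) := by
  intro s t hst
  simp only [hc.sub_spec_dot]
  refine Finset.sum_le_sum fun g _ => ?_
  have := hc.wt_mono g hst
  have := wt_le_one k g t
  have := comp_nonneg p g v
  have : 0 ≤ 1 - wt k g t := by linarith
  gcongr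

lemma continuous_spec_dot (hc : IsChain p k) (v : Fin n → ℝ) :
    Continuous fun t => spec p k t v ⬝ᵥ spec p k t v := by
  simp only [hc.spec_dot]
  have := continuous_wt k
  fun_prop

lemma continuous_sub_spec_dot (hc : IsChain p k) (v : Fin n → ℝ) :
    Continuous fun t => (v - spec p k t v) ⬝ᵥ (v - spec p k t v) := by
  simp only [hc.sub_spec_dot]
  have := continuous_wt k
  fun_prop

lemma spec_zero (hc : IsChain p k) (v : Fin n → ℝ) : spec p k 0 v = 0 := by
  have : ∀ g, wt k g 0 = 0 := by
    intro g
    have e2 : (k g : ℝ) ≤ k (g + 1) := by exact_mod_cast hc.k_mono (Nat.le_succ g)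
    exact max_eq_left ((min_le_right _ _).trans (div_nonpos_of_nonpos_of_nonneg
      (by simp) (by linarith)))
  simp [spec, comb, this]

lemma spec_last (hc : IsChain p k) (hn : 1 ≤ n) (v : Fin n → ℝ) : spec p k n v = v := by
  obtain ⟨G, α, hG, h0, h1, ht, hlt, w1, w2, w3⟩ :=
    hc.exists_segment hn (Nat.cast_nonneg n) le_rfl
  have hle := hc.k_le (G + 1)
  have hlt' : (k G : ℝ) < k (G + 1) := by exact_mod_cast hlt
  have hle' : (k (G + 1) : ℝ) ≤ n := by exact_mod_cast hle
  have hα : α = 1 := by nlinarith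
  have hk : (k (G + 1) : ℝ) = n := by rw [hα] at ht; linarith
  rw [spec, hc.comb_wt_segment hG w1 w3, w2, hα, hc.full (G + 1) (by exact_mod_cast hk)]
  simp

/-- The distance of the interpolated projections at two times is controlled by the difference of
the squared residuals. -/
lemma spec_sub_dot_le (hc : IsChain p k) {s t : ℝ} (hst : s ≤ t) (v : Fin n → ℝ) :
    (spec p k t v - spec p k s v) ⬝ᵥ (spec p k t v - spec p k s v) ≤
      (v - spec p k s v) ⬝ᵥ (v - spec p k s v) - (v - spec p k t v) ⬝ᵥ (v - spec p k t v) := by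
  rw [hc.sub_spec_dot, hc.sub_spec_dot, spec, spec, comb_sub, hc.comb_dot,
    ← Finset.sum_sub_distrib]
  refine Finset.sum_le_sum fun g _ => ?_
  have h1 := hc.wt_mono g hst
  have h2 := wt_le_one k g t
  have h3 := comp_nonneg p g v
  rw [← sub_mul]
  refine mul_le_mul_of_nonneg_right ?_ h3
  -- For weights `a ≤ b ≤ 1` one has `(b - a)² ≤ (1 - a)² - (1 - b)²`.
  nlinarith

lemma sum_comp (hc : IsChain p k) (g : ℕ) (v w : Fin n → ℝ) :
    ∑ h ∈ Finset.range g, comp p h v w = v ⬝ᵥ p g w := by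
  simp only [hc.comp_eq]
  rw [Finset.sum_range_sub (fun h => p h v ⬝ᵥ w), hc.zero]
  simp [hc.symm]

lemma dot_sub_self (hc : IsChain p k) (g : ℕ) (v : Fin n → ℝ) :
    (v - p g v) ⬝ᵥ (v - p g v) = v ⬝ᵥ v - v ⬝ᵥ p g v := by
  simp only [dotProduct_sub, sub_dotProduct]
  rw [hc.dot_nest le_rfl, hc.symm]
  ring

lemma sum_comp_last (hc : IsChain p k) (v w : Fin n → ℝ) :
    ∑ h ∈ Finset.range n, comp p h v w = v ⬝ᵥ w := by
  rw [hc.sum_comp, hc.full n hc.k_last]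
  rfl

/-- The error of the estimator stopped at `τ` in terms of the balanced time `b`. -/
lemma loss_le (hc : IsChain p k) (hn : 1 ≤ n) (F e : Fin n → ℝ) {τ b K a c : ℝ}
    (hτK : (F + e - spec p k τ (F + e)) ⬝ᵥ (F + e - spec p k τ (F + e)) ≤ K)
    (hτK' : 0 < τ → (F + e - spec p k τ (F + e)) ⬝ᵥ (F + e - spec p k τ (F + e)) = K)
    (hb0 : 0 ≤ b) (hbn : b ≤ n)
    (hb : (F - spec p k b F) ⬝ᵥ (F - spec p k b F) = spec p k b e ⬝ᵥ spec p k b e)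
    (ha : 0 ≤ a) (hc0 : 0 ≤ c) (hK : ∀ g ≤ n, extProj (p g) F e ≤ a * k g + c) :
    (spec p k τ (F + e) - F) ⬝ᵥ (spec p k τ (F + e) - F) ≤
      9 * (spec p k b e ⬝ᵥ spec p k b e) + 2 * |K - e ⬝ᵥ e| + 4 * a * b + 3 * c := by
  obtain ⟨G, α, hG, h0, h1, hbt, hlt, w1, w2, w3⟩ := hc.exists_segment hn hb0 hbn
  set R := (F + e - spec p k b (F + e)) ⬝ᵥ (F + e - spec p k b (F + e)) with hR
  set x := spec p k b e ⬝ᵥ spec p k b e with hx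
  set V := (spec p k b (F + e) - F) ⬝ᵥ (spec p k b (F + e) - F) with hV
  have huv : (spec p k τ (F + e) - F) ⬝ᵥ (spec p k τ (F + e) - F) ≤
      2 * ((spec p k τ (F + e) - spec p k b (F + e)) ⬝ᵥ
        (spec p k τ (F + e) - spec p k b (F + e))) + 2 * V := by
    have := dot_add_self_le (spec p k τ (F + e) - spec p k b (F + e)) (spec p k b (F + e) - F)
    rwa [sub_add_sub_cancel] at this
  -- expansion of the sums along the segment containing `b`
  have seg : ∀ (φ : ℝ → ℝ) (v w : Fin n → ℝ),
      ∑ g ∈ Finset.range n, φ (wt k g b) * comp p g v w =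
        φ 1 * (v ⬝ᵥ p G w) + φ α * (v ⬝ᵥ p (G + 1) w - v ⬝ᵥ p G w) +
          φ 0 * (v ⬝ᵥ w - v ⬝ᵥ p (G + 1) w) := by
    intro φ v w
    have := sum_segment hG (fun g => φ (wt k g b)) (φ α) (φ 1) (φ 0)
      (fun g hg => by simp only [w1 g hg]) (by simp only [w2]) (fun g hg => by simp only [w3 g hg])
      (fun g => comp p g v w)
    simp only [smul_eq_mul] at this
    rw [this, hc.sum_comp_last, hc.sum_comp G, hc.sum_comp (G + 1), hc.comp_eq, hc.symm, hc.symm]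
  -- By balance `x` is both the bias and the stochastic error. The first form matches the
  -- combination of `A, A'` in the Young bounds; the second removes the noise energy from the
  -- residual.
  have xF : x = (1 - α) ^ 2 * (F ⬝ᵥ p (G + 1) F - F ⬝ᵥ p G F) +
      (F ⬝ᵥ F - F ⬝ᵥ p (G + 1) F) := by
    rw [← hb, hc.sub_spec_dot, seg (fun w => (1 - w) ^ 2)]
    ring
  have xe : x = e ⬝ᵥ p G e + α ^ 2 * (e ⬝ᵥ p (G + 1) e - e ⬝ᵥ p G e) := by
    rw [hx, hc.spec_dot, seg (fun w => w ^ 2)]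
    ring
  have hVe : V = 2 * x - 2 * α * (1 - α) * (e ⬝ᵥ p (G + 1) F - e ⬝ᵥ p G F) := by
    have e1 : spec p k b (F + e) - F = spec p k b e - (F - spec p k b F) := by
      rw [spec, spec, spec, comb_add_vec]
      abel
    have e2 : spec p k b e ⬝ᵥ (F - spec p k b F) =
        α * (1 - α) * (e ⬝ᵥ p (G + 1) F - e ⬝ᵥ p G F) := by
      rw [hc.sub_spec, spec, hc.comb_dot, seg (fun w => w * (1 - w))]
      ring
    rw [hV, e1]
    simp only [dotProduct_sub, sub_dotProduct] at hb e2 ⊢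
    rw [dotProduct_comm (spec p k b F) (spec p k b e), dotProduct_comm F (spec p k b e)]
    linarith
  have hRe : R - e ⬝ᵥ e = 2 * (1 - α) ^ 2 * (e ⬝ᵥ p (G + 1) F - e ⬝ᵥ p G F) +
      2 * (e ⬝ᵥ F - e ⬝ᵥ p (G + 1) F) - 2 * α * (1 - α) *
        (e ⬝ᵥ p (G + 1) e - e ⬝ᵥ p G e) := by
    have e1 : R = x + 2 * ((1 - α) ^ 2 * (e ⬝ᵥ p (G + 1) F - e ⬝ᵥ p G F) +
        (e ⬝ᵥ F - e ⬝ᵥ p (G + 1) F)) + ((1 - α) ^ 2 * (e ⬝ᵥ p (G + 1) e - e ⬝ᵥ p G e) +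
        (e ⬝ᵥ e - e ⬝ᵥ p (G + 1) e)) := by
      rw [hR, hc.sub_spec_dot]
      simp only [comp_add_self, mul_add, Finset.sum_add_distrib]
      have e3 := seg (fun w => (1 - w) ^ 2 * 2) e F
      simp only [comp_comm p _ e F, mul_assoc] at e3
      rw [e3, seg (fun w => (1 - w) ^ 2) F F, seg (fun w => (1 - w) ^ 2) e e, xF]
      ring
    rw [e1]
    linarith
  have hkk : (k G : ℝ) ≤ k (G + 1) := by exact_mod_cast hlt.le
  have hm := hK G hG.le
  have hm' := hK (G + 1) hG
  unfold extProj at hm hm'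
  have hpos : ∀ g, 0 ≤ e ⬝ᵥ p g e := by
    intro g
    rw [← hc.symm, ← hc.dot_nest le_rfl]
    exact dot_self_nonneg _
  have hC := sq_le_mul_div e (F - p G F)
  have hC' := sq_le_mul_div e (F - p (G + 1) F)
  have hA := dot_self_nonneg (F - p G F)
  have hA' := dot_self_nonneg (F - p (G + 1) F)
  have hz : 0 ≤ (e ⬝ᵥ (F - p G F)) ^ 2 / ((F - p G F) ⬝ᵥ (F - p G F)) := by positivity
  have hz' : 0 ≤ (e ⬝ᵥ (F - p (G + 1) F)) ^ 2 / ((F - p (G + 1) F) ⬝ᵥ (F - p (G + 1) F)) := by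
    positivity
  have hq : 0 ≤ e ⬝ᵥ p (G + 1) e - e ⬝ᵥ p G e := by
    have := comp_nonneg p G e
    rwa [hc.comp_eq, hc.symm, hc.symm] at this
  have hmz : (e ⬝ᵥ (F - p G F)) ^ 2 / ((F - p G F) ⬝ᵥ (F - p G F)) ≤ a * k G + c := by
    linarith [hpos G]
  have hmz' : (e ⬝ᵥ p (G + 1) e - e ⬝ᵥ p G e) + (e ⬝ᵥ (F - p (G + 1) F)) ^ 2 /
      ((F - p (G + 1) F) ⬝ᵥ (F - p (G + 1) F)) ≤ a * k (G + 1) + c := by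
    linarith [hpos G]
  have up := upper_case h0 h1 (Nat.cast_nonneg (k G)) hkk hA hA' hz hz' ha hc0 hq hC hC' hmz hmz'
  have lo := lower_case h0 h1 (Nat.cast_nonneg (k G)) hkk hA hA' hz hz' ha hc0 hq hC hC' hmz hmz'
  -- After this rewriting the combination of biases is `x` and the interpolated dimension is `b`.
  rw [← hbt, hc.dot_sub_self, hc.dot_sub_self] at up lo
  rw [dotProduct_sub, dotProduct_sub] at up lo
  have habs := neg_abs_le (K - e ⬝ᵥ e)
  have habs' := le_abs_self (K - e ⬝ᵥ e)
  -- For `τ ≤ b` only the inequality between the residual and `K` is needed. For `τ > b ≥ 0` the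
  -- time is positive, so the residual equals `K`. In both cases `2V` contributes `4x` up to a cross
  -- term.
  rcases le_or_gt τ b with hτb | hτb
  · have hu := hc.spec_sub_dot_le hτb (F + e)
    rw [← neg_sub (spec p k b (F + e)), neg_dotProduct, dotProduct_neg, neg_neg] at huv
    linarith
  · have hu := hc.spec_sub_dot_le hτb.le (F + e)
    rw [hτK' (hb0.trans_lt hτb)] at hu
    linarith

end IsChain

/-! ### Partitions reachable by successive admissible splits -/

/-- The relation between indices induced by a partition. -/
def rel {n d : ℕ} (x : Fin n → Fin d → ℝ) (P : Set (Set (Fin d → ℝ))) : Fin n → Fin n → Prop :=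
  fun i i' => SameNode P (x i) (x i')

/-- The partition obtained from `P` by splitting the node `A` at `(j, c)`. -/
def splitNode {d : ℕ} (P : Set (Set (Fin d → ℝ))) (A : Set (Fin d → ℝ)) (j : Fin d) (c : ℝ) :
    Set (Set (Fin d → ℝ)) := (P \ {A}) ∪ {leftChild A j c, rightChild A j c}

/-- The partitions arising from the root by `m` admissible splits. -/
inductive Reach {n d : ℕ} (x : Fin n → Fin d → ℝ) : ℕ → Set (Set (Fin d → ℝ)) → Prop
  | root : Reach x 0 {Set.univ}
  | split {m : ℕ} {P : Set (Set (Fin d → ℝ))} {A : Set (Fin d → ℝ)} {j : Fin d} {c : ℝ} :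
      Reach x m P → A ∈ P → AdmissibleSplit x A j c → Reach x (m + 1) (splitNode P A j c)

lemma one_le_nodeSize {n d : ℕ} {x : Fin n → Fin d → ℝ} {A : Set (Fin d → ℝ)} :
    1 ≤ nodeSize x A ↔ ∃ i, x i ∈ A := by
  simp [nodeSize, Nat.one_le_iff_ne_zero, nodeIdx, Finset.filter_eq_empty_iff]

lemma mem_nodeIdx {n d : ℕ} {x : Fin n → Fin d → ℝ} {A : Set (Fin d → ℝ)} {i : Fin n} :
    i ∈ nodeIdx x A ↔ x i ∈ A := by
  simp [nodeIdx]

lemma mem_splitNode {d : ℕ} {P : Set (Set (Fin d → ℝ))} {A B : Set (Fin d → ℝ)} {j : Fin d}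
    {c : ℝ} : B ∈ splitNode P A j c ↔
      (B ∈ P ∧ B ≠ A) ∨ B = leftChild A j c ∨ B = rightChild A j c := by
  simp only [splitNode, Set.mem_union, Set.mem_sdiff, Set.mem_singleton_iff, Set.mem_insert_iff, ne_eq]

lemma leftChild_subset {d : ℕ} (A : Set (Fin d → ℝ)) (j : Fin d) (c : ℝ) :
    leftChild A j c ⊆ A := fun _ h => h.1

lemma rightChild_subset {d : ℕ} (A : Set (Fin d → ℝ)) (j : Fin d) (c : ℝ) :
    rightChild A j c ⊆ A := fun _ h => h.1

lemma AdmissibleSplit.leftChild_ne {n d : ℕ} {x : Fin n → Fin d → ℝ} {A : Set (Fin d → ℝ)}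
    {j : Fin d} {c : ℝ} (h : AdmissibleSplit x A j c) : leftChild A j c ≠ A := by
  intro he
  obtain ⟨i, hi⟩ := one_le_nodeSize.1 h.2
  have : x i ∈ leftChild A j c := he.symm ▸ hi.1
  exact absurd this.2 (not_lt.2 hi.2)

lemma AdmissibleSplit.rightChild_ne {n d : ℕ} {x : Fin n → Fin d → ℝ} {A : Set (Fin d → ℝ)}
    {j : Fin d} {c : ℝ} (h : AdmissibleSplit x A j c) : rightChild A j c ≠ A := by
  intro he
  obtain ⟨i, hi⟩ := one_le_nodeSize.1 h.1
  have : x i ∈ rightChild A j c := he.symm ▸ hi.1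
  exact absurd this.2 (not_le.2 hi.2)

lemma AdmissibleSplit.leftChild_ne_rightChild {n d : ℕ} {x : Fin n → Fin d → ℝ}
    {A : Set (Fin d → ℝ)} {j : Fin d} {c : ℝ} (h : AdmissibleSplit x A j c) :
    leftChild A j c ≠ rightChild A j c := by
  intro he
  obtain ⟨i, hi⟩ := one_le_nodeSize.1 h.1
  have : x i ∈ rightChild A j c := he ▸ hi
  exact absurd this.2 (not_le.2 hi.2)

/-! ### Encoding of partitions by cuts at design points -/

/-- The refinement of a relation by cutting the class of the point `q.2` along the coordinate
`q.1` at the position of that point. -/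
def splitRel {n d : ℕ} (x : Fin n → Fin d → ℝ) (r : Fin n → Fin n → Prop) (q : Fin d × Fin n) :
    Fin n → Fin n → Prop :=
  fun i i' => r i i' ∧ (r q.2 i → (x i q.1 < x q.2 q.1 ↔ x i' q.1 < x q.2 q.1))

/-- The relation described by a list of cuts. -/
def decode {n d : ℕ} (x : Fin n → Fin d → ℝ) : List (Fin d × Fin n) → Fin n → Fin n → Prop
  | [] => fun _ _ => True
  | q :: l => splitRel x (decode x l) q

/-- The classes of a relation. -/
noncomputable def classes {n : ℕ} (r : Fin n → Fin n → Prop) : Finset (Finset (Fin n)) :=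
  Finset.univ.image (cls r)

lemma equivalence_splitRel {n d : ℕ} (x : Fin n → Fin d → ℝ) {r : Fin n → Fin n → Prop}
    (hr : Equivalence r) (q : Fin d × Fin n) : Equivalence (splitRel x r q) where
  refl i := ⟨hr.refl i, fun _ => Iff.rfl⟩
  symm h := ⟨hr.symm h.1, fun h' => (h.2 (hr.trans h' (hr.symm h.1))).symm⟩
  trans h h' := ⟨hr.trans h.1 h'.1, fun h0 => (h.2 h0).trans (h'.2 (hr.trans h0 h.1))⟩

lemma equivalence_decode {n d : ℕ} (x : Fin n → Fin d → ℝ) (l : List (Fin d × Fin n)) :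
    Equivalence (decode x l) := by
  induction l with
  | nil => exact ⟨fun _ => trivial, fun _ => trivial, fun _ _ => trivial⟩
  | cons q l ih => exact equivalence_splitRel x ih q

/-- Only the class of `q.2` is affected, and it is replaced by at most two pieces. A cut in an
arbitrary list may leave one piece empty, hence an inequality. -/
lemma card_classes_splitRel {n d : ℕ} (x : Fin n → Fin d → ℝ) {r : Fin n → Fin n → Prop}
    (hr : Equivalence r) (q : Fin d × Fin n) :
    (classes (splitRel x r q)).card ≤ (classes r).card + 1 := by
  classical
  set L := (cls r q.2).filter (fun i => x i q.1 < x q.2 q.1) with hL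
  set R := (cls r q.2).filter (fun i => ¬ x i q.1 < x q.2 q.1) with hR
  have hsub : classes (splitRel x r q) ⊆ (classes r).erase (cls r q.2) ∪ {L, R} := by
    intro b hb
    obtain ⟨i, -, rfl⟩ := Finset.mem_image.1 hb
    by_cases hi : r q.2 i
    · refine Finset.mem_union_right _ ?_
      rw [Finset.mem_insert, Finset.mem_singleton]
      by_cases hlt : x i q.1 < x q.2 q.1
      · left
        ext l
        simp only [mem_cls, splitRel, hL, Finset.mem_filter, hlt, true_iff, hi, forall_const]
        exact ⟨fun h => ⟨hr.trans hi h.1, h.2⟩, fun h => ⟨hr.trans (hr.symm hi) h.1, h.2⟩⟩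
      · right
        ext l
        simp only [mem_cls, splitRel, hR, Finset.mem_filter, hlt, false_iff, hi, forall_const]
        exact ⟨fun h => ⟨hr.trans hi h.1, h.2⟩, fun h => ⟨hr.trans (hr.symm hi) h.1, h.2⟩⟩
    · refine Finset.mem_union_left _ (Finset.mem_erase.2 ⟨?_, Finset.mem_image.2 ⟨i, Finset.mem_univ _, ?_⟩⟩)
      · intro h
        have : q.2 ∈ cls (splitRel x r q) i := h ▸ mem_cls.2 (hr.refl q.2)
        exact hi (hr.symm (mem_cls.1 this).1)
      · ext l
        simp [mem_cls, splitRel, hi]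
  refine (Finset.card_le_card hsub).trans ((Finset.card_union_le _ _).trans ?_)
  have hmem : cls r q.2 ∈ classes r := Finset.mem_image_of_mem _ (Finset.mem_univ _)
  have h1 := Finset.card_erase_of_mem hmem
  have h2 : ({L, R} : Finset (Finset (Fin n))).card ≤ 2 := Finset.card_le_two
  have h3 : 0 < (classes r).card := Finset.card_pos.2 ⟨_, hmem⟩
  omega

lemma card_classes_decode {n d : ℕ} (x : Fin n → Fin d → ℝ) (l : List (Fin d × Fin n)) :
    (classes (decode x l)).card ≤ l.length + 1 := by
  induction l with
  | nil =>
    refine Finset.card_le_one.2 fun a ha b hb => ?_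
    obtain ⟨i, -, rfl⟩ := Finset.mem_image.1 ha
    obtain ⟨i', -, rfl⟩ := Finset.mem_image.1 hb
    exact cls_eq_of_rel (equivalence_decode x []) trivial
  | cons q l ih =>
    have := card_classes_splitRel x (equivalence_decode x l) q
    simp only [decode, List.length_cons]
    omega

/-! ### Combinatorics of reachable partitions -/

namespace Reach

variable {n d : ℕ} {x : Fin n → Fin d → ℝ} {m : ℕ} {P : Set (Set (Fin d → ℝ))}

lemma eq_of_mem (h : Reach x m P) : ∀ A ∈ P, ∀ B ∈ P, ∀ z, z ∈ A → z ∈ B → A = B := by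
  induction h with
  | root =>
    intro A hA B hB _ _ _
    rw [Set.mem_singleton_iff.1 hA, Set.mem_singleton_iff.1 hB]
  | @split m P A j c _ hA hadm ih =>
    intro B hB C hC z hzB hzC
    have hn : ∀ D ∈ P, D ≠ A → z ∈ D → z ∈ A → False := fun D hD hne h1 h2 =>
      hne (ih D hD A hA z h1 h2)
    rcases mem_splitNode.1 hB with ⟨h1, h1'⟩ | rfl | rfl <;>
      rcases mem_splitNode.1 hC with ⟨h2, h2'⟩ | rfl | rfl
    · exact ih B h1 C h2 z hzB hzC
    · exact (hn B h1 h1' hzB hzC.1).elim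
    · exact (hn B h1 h1' hzB hzC.1).elim
    · exact (hn C h2 h2' hzC hzB.1).elim
    · rfl
    · exact absurd hzB.2 (not_lt.2 hzC.2)
    · exact (hn C h2 h2' hzC hzB.1).elim
    · exact absurd hzC.2 (not_lt.2 hzB.2)
    · rfl

lemma exists_mem (h : Reach x m P) (z : Fin d → ℝ) : ∃ A ∈ P, z ∈ A := by
  induction h with
  | root => exact ⟨Set.univ, rfl, trivial⟩
  | @split m P A j c _ hA hadm ih =>
    obtain ⟨B, hB, hz⟩ := ih
    by_cases hBA : B = A
    · subst hBA
      rcases lt_or_ge (z j) c with hlt | hge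
      · exact ⟨_, mem_splitNode.2 (Or.inr (Or.inl rfl)), hz, hlt⟩
      · exact ⟨_, mem_splitNode.2 (Or.inr (Or.inr rfl)), hz, hge⟩
    · exact ⟨B, mem_splitNode.2 (Or.inl ⟨hB, hBA⟩), hz⟩

lemma one_le_size (h : Reach x m P) (hn : 1 ≤ n) : ∀ A ∈ P, 1 ≤ nodeSize x A := by
  induction h with
  | root =>
    intro A hA
    rw [Set.mem_singleton_iff.1 hA]
    exact one_le_nodeSize.2 ⟨⟨0, hn⟩, trivial⟩
  | @split m P A j c _ hA hadm ih =>
    intro B hB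
    rcases mem_splitNode.1 hB with ⟨h1, -⟩ | rfl | rfl
    · exact ih B h1
    · exact hadm.1
    · exact hadm.2

/-- Distinct nodes are disjoint, and the child contains a design point of its parent. Thus children
are new nodes and each split raises the count by exactly one. -/
lemma child_notMem (h : Reach x m P) {A B : Set (Fin d → ℝ)} (hA : A ∈ P) (hBA : B ⊆ A)
    (hne : B ≠ A) (hB : 1 ≤ nodeSize x B) : B ∉ P := by
  intro hBP
  obtain ⟨i, hi⟩ := one_le_nodeSize.1 hB
  exact hne (h.eq_of_mem B hBP A hA (x i) hi (hBA hi))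

lemma finite_ncard (h : Reach x m P) : P.Finite ∧ P.ncard = m + 1 := by
  induction h with
  | root => simp
  | @split m P A j c hr hA hadm ih =>
    obtain ⟨hf, hcard⟩ := ih
    have hfin : (P \ {A}).Finite := hf.subset Set.sdiff_subset
    refine ⟨hfin.union (Set.toFinite _), ?_⟩
    rw [splitNode, Set.ncard_union_eq _ hfin (Set.toFinite _),
      Set.ncard_pair hadm.leftChild_ne_rightChild, Set.ncard_sdiff_singleton_of_mem hA, hcard]
    · omega
    · rw [Set.disjoint_right]
      intro B hB hB'
      rcases hB with rfl | hB
      · exact hr.child_notMem hA (leftChild_subset _ _ _) hadm.leftChild_ne hadm.1 hB'.1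
      · rw [Set.mem_singleton_iff] at hB
        subst hB
        exact hr.child_notMem hA (rightChild_subset _ _ _) hadm.rightChild_ne hadm.2 hB'.1

lemma equivalence (h : Reach x m P) : Equivalence (rel x P) where
  refl i := by
    obtain ⟨A, hA, hi⟩ := h.exists_mem (x i)
    exact ⟨A, hA, hi, hi⟩
  symm := by
    rintro i i' ⟨A, hA, h1, h2⟩
    exact ⟨A, hA, h2, h1⟩
  trans := by
    rintro i i' i'' ⟨A, hA, h1, h2⟩ ⟨B, hB, h3, h4⟩
    exact ⟨A, hA, h1, h.eq_of_mem A hA B hB _ h2 h3 ▸ h4⟩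

lemma rel_iff (h : Reach x m P) {A : Set (Fin d → ℝ)} (hA : A ∈ P) {i i' : Fin n}
    (hi : x i ∈ A) : rel x P i i' ↔ x i' ∈ A := by
  constructor
  · rintro ⟨B, hB, h1, h2⟩
    exact h.eq_of_mem B hB A hA _ h1 hi ▸ h2
  · exact fun h' => ⟨A, hA, hi, h'⟩

lemma rel_splitNode (h : Reach x m P) {A : Set (Fin d → ℝ)} (hA : A ∈ P) {j : Fin d} {c : ℝ}
    (i i' : Fin n) :
    rel x (splitNode P A j c) i i' ↔
      rel x P i i' ∧ (x i ∈ A → (x i j < c ↔ x i' j < c)) := by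
  constructor
  · rintro ⟨B, hB, h1, h2⟩
    rcases mem_splitNode.1 hB with ⟨hBP, hne⟩ | rfl | rfl
    · exact ⟨⟨B, hBP, h1, h2⟩, fun h3 => absurd (h.eq_of_mem B hBP A hA _ h1 h3) hne⟩
    · exact ⟨⟨A, hA, h1.1, h2.1⟩, fun _ => by simp [h1.2, h2.2]⟩
    · exact ⟨⟨A, hA, h1.1, h2.1⟩, fun _ => by simp [not_lt.2 h1.2, not_lt.2 h2.2]⟩
  · rintro ⟨⟨B, hB, h1, h2⟩, h3⟩
    by_cases hBA : B = A
    · subst hBA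
      rcases lt_or_ge (x i j) c with hlt | hge
      · exact ⟨_, mem_splitNode.2 (Or.inr (Or.inl rfl)), ⟨h1, hlt⟩, h2, (h3 h1).1 hlt⟩
      · refine ⟨_, mem_splitNode.2 (Or.inr (Or.inr rfl)), ⟨h1, hge⟩, h2, ?_⟩
        exact not_lt.1 fun h4 => absurd ((h3 h1).2 h4) (not_lt.2 hge)
    · exact ⟨B, mem_splitNode.2 (Or.inl ⟨hB, hBA⟩), h1, h2⟩

/-- A reachable partition is described by as many cuts as there were splits. -/
lemma exists_decode (h : Reach x m P) :
    ∃ l : List (Fin d × Fin n), l.length = m ∧ rel x P = decode x l := by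
  classical
  induction h with
  | root =>
    refine ⟨[], rfl, ?_⟩
    funext i i'
    exact propext ⟨fun _ => trivial, fun _ => ⟨Set.univ, rfl, trivial, trivial⟩⟩
  | @split m P A j c hr hA hadm ih =>
    obtain ⟨l, hl, hrel⟩ := ih
    have hne : (nodeIdx x (rightChild A j c)).Nonempty := by
      obtain ⟨i, hi⟩ := one_le_nodeSize.1 hadm.2
      exact ⟨i, mem_nodeIdx.2 hi⟩
    -- The threshold is moved to the smallest `j`-coordinate among design points in the right child;
    -- no design point of `A` changes sides. Since `i0` lies in `A`, the pair `(j, i0)` also records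
    -- which node is split.
    obtain ⟨i0, hi0, hmin⟩ := Finset.exists_min_image _ (fun i => x i j) hne
    rw [mem_nodeIdx] at hi0
    have hcut : ∀ i, x i ∈ A → (x i j < c ↔ x i j < x i0 j) := by
      intro i hi
      constructor
      · exact fun h => h.trans_le hi0.2
      · intro h
        by_contra h'
        exact absurd (hmin i (mem_nodeIdx.2 ⟨hi, not_lt.1 h'⟩)) (not_le.2 h)
    refine ⟨(j, i0) :: l, by simp [hl], ?_⟩
    funext i i'
    rw [decode, ← hrel, eq_iff_iff, hr.rel_splitNode hA]
    simp only [splitRel, hr.rel_iff hA hi0.1]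
    refine and_congr_right fun h1 => forall_congr' fun h2 => ?_
    rw [hcut i h2, hcut i' ((hr.rel_iff hA h2).1 h1)]

lemma sum_size (h : Reach x m P) : ∑ A ∈ h.finite_ncard.1.toFinset, nodeSize x A = n := by
  classical
  have hdisj : (h.finite_ncard.1.toFinset : Set (Set (Fin d → ℝ))).PairwiseDisjoint
      (nodeIdx x) := by
    intro A hA B hB hne
    simp only [Set.Finite.coe_toFinset] at hA hB
    refine Finset.disjoint_left.2 fun i hiA hiB => hne ?_
    exact h.eq_of_mem A hA B hB _ (mem_nodeIdx.1 hiA) (mem_nodeIdx.1 hiB)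
  simp only [nodeSize]
  rw [← Finset.card_biUnion hdisj]
  have : h.finite_ncard.1.toFinset.biUnion (nodeIdx x) = Finset.univ := by
    refine Finset.eq_univ_iff_forall.2 fun i => ?_
    obtain ⟨A, hA, hi⟩ := h.exists_mem (x i)
    exact Finset.mem_biUnion.2 ⟨A, h.finite_ncard.1.mem_toFinset.2 hA, mem_nodeIdx.2 hi⟩
  rw [this, Finset.card_univ, Fintype.card_fin]

lemma card_toFinset (h : Reach x m P) : h.finite_ncard.1.toFinset.card = m + 1 := by
  rw [← Set.ncard_eq_toFinset_card P h.finite_ncard.1]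
  exact h.finite_ncard.2

lemma succ_le (h : Reach x m P) (hn : 1 ≤ n) : m + 1 ≤ n := by
  have h1 : ∑ A ∈ h.finite_ncard.1.toFinset, 1 ≤ ∑ A ∈ h.finite_ncard.1.toFinset, nodeSize x A :=
    Finset.sum_le_sum fun A hA => h.one_le_size hn A (h.finite_ncard.1.mem_toFinset.1 hA)
  rw [h.sum_size, Finset.sum_const, h.card_toFinset] at h1
  simpa using h1

/-- The `m + 1` node sizes sum to `n` and each is at least one. -/
lemma succ_eq_iff (h : Reach x m P) (hn : 1 ≤ n) :
    m + 1 = n ↔ ∀ A ∈ P, nodeSize x A ≤ 1 := by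
  have h1 : ∀ A ∈ h.finite_ncard.1.toFinset, 1 ≤ nodeSize x A :=
    fun A hA => h.one_le_size hn A (h.finite_ncard.1.mem_toFinset.1 hA)
  have h2 := Finset.sum_eq_sum_iff_of_le h1
  rw [h.sum_size, Finset.sum_const, h.card_toFinset, smul_eq_mul, mul_one] at h2
  rw [h2]
  refine ⟨fun h3 A hA => (h3 A (h.finite_ncard.1.mem_toFinset.2 hA)).ge, fun h3 A hA => ?_⟩
  exact le_antisymm (h1 A hA) (h3 A (h.finite_ncard.1.mem_toFinset.1 hA))

lemma rel_eq (h : Reach x m P) (hs : ∀ A ∈ P, nodeSize x A ≤ 1) (i i' : Fin n) :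
    rel x P i i' ↔ i = i' := by
  refine ⟨?_, fun he => he ▸ h.equivalence.refl i⟩
  rintro ⟨A, hA, h1, h2⟩
  exact Finset.card_le_one.1 (hs A hA) i (mem_nodeIdx.2 h1) i' (mem_nodeIdx.2 h2)

/-- Splitting several nodes of a reachable partition simultaneously. -/
lemma split_many (h : Reach x m P) (hn : 1 ≤ n) (j : Set (Fin d → ℝ) → Fin d)
    (c : Set (Fin d → ℝ) → ℝ) (T : Set (Set (Fin d → ℝ))) (hT : T.Finite) (hTP : T ⊆ P)
    (hadm : ∀ A ∈ T, AdmissibleSplit x A (j A) (c A)) :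
    Reach x (m + T.ncard)
      ((P \ T) ∪ {B | ∃ A ∈ T, B = leftChild A (j A) (c A) ∨ B = rightChild A (j A) (c A)}) := by
  induction T, hT using Set.Finite.induction_on with
  | empty => simpa using h
  | @insert A T hAT hT ih =>
    have hAP : A ∈ P := hTP (Set.mem_insert _ _)
    have ih' := ih (fun B hB => hTP (Set.mem_insert_of_mem _ hB))
      (fun B hB => hadm B (Set.mem_insert_of_mem _ hB))
    have := ih'.split (Or.inl ⟨hAP, hAT⟩) (hadm A (Set.mem_insert _ _))
    rw [Set.ncard_insert_of_notMem hAT hT, ← add_assoc]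
    convert this using 1
    ext B
    rw [mem_splitNode]
    -- Splitting `A` last must not delete a child of an earlier split; such children are not nodes
    -- of `P`, while `A` is.
    have hchild : ∀ C ∈ T, (B = leftChild C (j C) (c C) ∨ B = rightChild C (j C) (c C)) →
        B ≠ A := by
      rintro C hC hB rfl
      have hCP : C ∈ P := hTP (Set.mem_insert_of_mem _ hC)
      have hCadm := hadm C (Set.mem_insert_of_mem _ hC)
      rcases hB with hB | hB
      · exact h.child_notMem hCP (hB ▸ leftChild_subset _ _ _)
          (hB ▸ hCadm.leftChild_ne) (h.one_le_size hn _ hAP) hAP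
      · exact h.child_notMem hCP (hB ▸ rightChild_subset _ _ _)
          (hB ▸ hCadm.rightChild_ne) (h.one_le_size hn _ hAP) hAP
    constructor
    · rintro (⟨h1, h2⟩ | ⟨C, rfl | hC, h2⟩)
      · rw [Set.mem_insert_iff, not_or] at h2
        exact Or.inl ⟨Or.inl ⟨h1, h2.2⟩, h2.1⟩
      · exact Or.inr h2
      · exact Or.inl ⟨Or.inr ⟨C, hC, h2⟩, hchild C hC h2⟩
    · rintro (⟨⟨h1, h1'⟩ | ⟨C, hC, h2⟩, h3⟩ | h2)
      · exact Or.inl ⟨h1, by rw [Set.mem_insert_iff, not_or]; exact ⟨h3, h1'⟩⟩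
      · exact Or.inr ⟨C, Set.mem_insert_of_mem _ hC, h2⟩
      · exact Or.inr ⟨A, Set.mem_insert _ _, h2⟩

/-- One growth step from a reachable partition. -/
lemma step (h : Reach x m P) (hn : 1 ≤ n) {rule : GrowthRule} {y : Fin n → ℝ}
    {P' : Set (Set (Fin d → ℝ))} (hs : rule.Step x y P P') :
    ∃ m', Reach x m' P' ∧ (∀ B ∈ P', ∃ A ∈ P, B ⊆ A) ∧
      (((∀ A ∈ P, nodeSize x A ≤ 1) ∧ m' = m) ∨ m < m') := by
  cases rule with
  | semiGlobal =>
    rcases hs with ⟨A, hA, -, -, j, c, hsplit, rfl⟩ | ⟨h1, rfl⟩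
    · refine ⟨m + 1, h.split hA hsplit.1, fun B hB => ?_, Or.inr (Nat.lt_succ_self m)⟩
      rcases mem_splitNode.1 hB with ⟨h1, -⟩ | rfl | rfl
      · exact ⟨B, h1, subset_rfl⟩
      · exact ⟨A, hA, leftChild_subset _ _ _⟩
      · exact ⟨A, hA, rightChild_subset _ _ _⟩
    · exact ⟨m, h, fun B hB => ⟨B, hB, subset_rfl⟩, Or.inl ⟨h1, rfl⟩⟩
  | global =>
    obtain ⟨j, c, h1, rfl⟩ := hs
    set T := {A | A ∈ P ∧ 1 < nodeSize x A} with hTdef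
    have hTP : T ⊆ P := fun A hA => hA.1
    have hT : T.Finite := h.finite_ncard.1.subset hTP
    have key := h.split_many hn j c T hT hTP (fun A hA => (h1 A hA.1 hA.2).1)
    refine ⟨m + T.ncard, ?_, ?_, ?_⟩
    · convert key using 1
      ext B
      constructor
      · rintro ⟨A, hA, ⟨h2, rfl⟩ | ⟨h2, h3⟩⟩
        · exact Or.inl ⟨hA, fun h3 => absurd h3.2 (not_lt.2 h2)⟩
        · exact Or.inr ⟨A, ⟨hA, h2⟩, h3⟩
      · rintro (⟨hB, h2⟩ | ⟨A, ⟨hA, h2⟩, h3⟩)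
        · exact ⟨B, hB, Or.inl ⟨not_lt.1 fun h3 => h2 ⟨hB, h3⟩, rfl⟩⟩
        · exact ⟨A, hA, Or.inr ⟨h2, h3⟩⟩
    · rintro B ⟨A, hA, ⟨-, rfl⟩ | ⟨-, rfl | rfl⟩⟩
      · exact ⟨B, hA, subset_rfl⟩
      · exact ⟨A, hA, leftChild_subset _ _ _⟩
      · exact ⟨A, hA, rightChild_subset _ _ _⟩
    · by_cases hall : ∀ A ∈ P, nodeSize x A ≤ 1
      · left
        have : T = ∅ := Set.eq_empty_iff_forall_notMem.2 fun A hA =>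
          absurd hA.2 (not_lt.2 (hall A hA.1))
        exact ⟨hall, by simp [this]⟩
      · right
        push Not at hall
        obtain ⟨A, hA, h2⟩ := hall
        have : 0 < T.ncard := (Set.ncard_pos hT).2 ⟨A, hA, h2⟩
        omega

end Reach

/-! ### The projections of a grown tree -/

namespace IsGrownTree

variable {n d : ℕ} {x : Fin n → Fin d → ℝ} {y : Fin n → ℝ} {P : ℕ → Set (Set (Fin d → ℝ))}
  {rule : GrowthRule}

lemma exists_reach (h : IsGrownTree rule x y P) (hn : 1 ≤ n) (g : ℕ) :
    ∃ m, Reach x m (P (g + 1)) := by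
  induction g with
  | zero => exact ⟨0, h.2.1 ▸ Reach.root⟩
  | succ g ih =>
    obtain ⟨m, hm⟩ := ih
    obtain ⟨m', hm', -⟩ := hm.step hn (h.2.2 (g + 1) (by omega))
    exact ⟨m', hm'⟩

lemma rel_zero (h : IsGrownTree rule x y P) (i i' : Fin n) : ¬ rel x (P 0) i i' := by
  rintro ⟨A, hA, -⟩
  rw [h.1] at hA
  exact hA

lemma rel_of_le (h : IsGrownTree rule x y P) (hn : 1 ≤ n) {g g' : ℕ} (hgg : g ≤ g')
    (i i' : Fin n) (hr : rel x (P (g' + 1)) i i') : rel x (P (g + 1)) i i' := by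
  induction g', hgg using Nat.le_induction with
  | base => exact hr
  | succ g' _ ih =>
    refine ih ?_
    obtain ⟨m, hm⟩ := h.exists_reach hn g'
    obtain ⟨m', -, href, -⟩ := hm.step hn (h.2.2 (g' + 1) (by omega))
    obtain ⟨B, hB, h1, h2⟩ := hr
    obtain ⟨A, hA, hBA⟩ := href B hB
    exact ⟨A, hA, hBA h1, hBA h2⟩

/-- Generation 0 is the empty partition, with zero projection and no nodes; all later ones are
reachable partitions, each refining the previous one. Growth cannot stall before `n` nodes, since
then some node holds at least two design points and a step splits it or another such node. -/
lemma isChain (h : IsGrownTree rule x y P) (hn : 1 ≤ n) :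
    IsChain (fun g => avg (rel x (P g))) (fun g => (P g).ncard) := by
  have h0 : avg (rel x (P 0)) = 0 := avg_eq_zero h.rel_zero
  have k0 : (P 0).ncard = 0 := by rw [h.1, Set.ncard_empty]
  have hstep : ∀ g, ∃ m m', Reach x m (P (g + 1)) ∧ Reach x m' (P (g + 2)) ∧
      (((∀ A ∈ P (g + 1), nodeSize x A ≤ 1) ∧ m' = m) ∨ m < m') := by
    intro g
    obtain ⟨m, hm⟩ := h.exists_reach hn g
    obtain ⟨m', hm', -, hmm⟩ := hm.step hn (h.2.2 (g + 1) (by omega))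
    exact ⟨m, m', hm, hm', hmm⟩
  refine ⟨?_, ?_, h0, k0, ?_, ?_, ?_, ?_⟩
  · rintro (_ | g) v w
    · simp [h0]
    · obtain ⟨m, hm⟩ := h.exists_reach hn g
      exact avg_symm hm.equivalence v w
  · rintro (_ | g) (_ | g') hgg v
    · simp [h0]
    · simp [h0]
    · omega
    · obtain ⟨m, hm⟩ := h.exists_reach hn g
      obtain ⟨m', hm'⟩ := h.exists_reach hn g'
      exact avg_avg_of_le hm.equivalence hm'.equivalence (h.rel_of_le hn (by omega)) v
  · rintro (_ | g)
    · simp [k0]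
    · obtain ⟨m, hm⟩ := h.exists_reach hn g
      simpa [hm.finite_ncard.2] using hm.succ_le hn
  · rintro (_ | g) hlt
    · simp [k0, h.2.1]
    · obtain ⟨m, m', hm, hm', hmm⟩ := hstep g
      simp only [hm.finite_ncard.2] at hlt ⊢
      rw [hm'.finite_ncard.2]
      rcases hmm with ⟨h1, -⟩ | h1
      · exact absurd ((hm.succ_eq_iff hn).2 h1) hlt.ne
      · omega
  · rintro (_ | g) heq
    · simp only [k0] at heq
      omega
    · obtain ⟨m, m', hm, hm', hmm⟩ := hstep g
      have := hm'.succ_le hn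
      simp only [hm.finite_ncard.2] at heq
      simp only [hm'.finite_ncard.2]
      rcases hmm with ⟨-, h1⟩ | h1 <;> omega
  · rintro (_ | g) heq
    · simp only [k0] at heq
      omega
    · obtain ⟨m, hm⟩ := h.exists_reach hn g
      simp only [hm.finite_ncard.2] at heq
      exact avg_eq_id (hm.rel_eq ((hm.succ_eq_iff hn).1 heq))

lemma flow_eq (h : IsGrownTree rule x y P) (hn : 1 ≤ n) {t : ℝ} (ht0 : 0 ≤ t) (htn : t ≤ n)
    (v : Fin n → ℝ) :
    flow x P t v = spec (fun g => avg (rel x (P g))) (fun g => (P g).ncard) t v := by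
  have hc := h.isChain hn
  rcases htn.lt_or_eq with hlt | rfl
  · obtain ⟨G, hG, h1, h2⟩ := hc.exists_between ht0 hlt
    obtain ⟨w1, w2, w3⟩ := hc.wt_of_between h1 h2.le (by exact_mod_cast h1.trans_lt h2)
    have hgen : genAt P t = G := by
      have : {g : ℕ | ((P g).ncard : ℝ) ≤ t} = Set.Iic G := by
        ext g
        rw [Set.mem_ofPred_eq, Set.mem_Iic]
        constructor
        · intro hg
          by_contra hgG
          have : ((P (G + 1)).ncard : ℝ) ≤ (P g).ncard := by
            exact_mod_cast hc.k_mono (show G + 1 ≤ g by omega)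
          linarith
        · intro hg
          have : ((P g).ncard : ℝ) ≤ (P G).ncard := by exact_mod_cast hc.k_mono hg
          linarith
      rw [genAt, this, csSup_Iic]
    rw [spec, hc.comb_wt_segment hG w1 w3, w2, flow, if_pos hlt, weightAt, hgen]
    rfl
  · rw [hc.spec_last hn, flow, if_neg (lt_irrefl _)]

end IsGrownTree

/-! ### Exponential moments of quadratic forms -/

open ProbabilityTheory in
lemma lintegral_exp_mul_gaussian (c : ℝ) :
    ∫⁻ g, ENNReal.ofReal (Real.exp (c * g)) ∂(gaussianReal 0 1) =
      ENNReal.ofReal (Real.exp (c ^ 2 / 2)) := by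
  rw [← ofReal_integral_eq_lintegral_ofReal (integrable_exp_mul_gaussianReal c)
    (Filter.Eventually.of_forall fun _ => (Real.exp_pos _).le)]
  have := mgf_gaussianReal (p := gaussianReal 0 1) (X := id) (μ := 0) (v := 1) Measure.map_id c
  simp only [mgf, id] at this
  rw [this]
  simp

open ProbabilityTheory in
lemma lintegral_exp_sq_gaussian :
    ∫⁻ g, ENNReal.ofReal (Real.exp (g ^ 2 / 4)) ∂(gaussianReal 0 1) =
      ENNReal.ofReal (Real.sqrt 2) := by
  rw [gaussianReal_of_var_ne_zero _ one_ne_zero,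
    lintegral_withDensity_eq_lintegral_mul _ (measurable_gaussianPDF 0 1) (by fun_prop)]
  have h1 : ∀ g : ℝ, (gaussianPDF 0 1 * fun g => ENNReal.ofReal (Real.exp (g ^ 2 / 4))) g =
      ENNReal.ofReal ((Real.sqrt (2 * Real.pi))⁻¹ * Real.exp (-(1 / 4) * g ^ 2)) := by
    intro g
    rw [Pi.mul_apply, gaussianPDF, ← ENNReal.ofReal_mul (gaussianPDFReal_nonneg _ _ _),
      gaussianPDFReal]
    congr 1
    rw [NNReal.coe_one, mul_one, mul_assoc, ← Real.exp_add]
    congr 2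
    ring
  simp only [h1]
  rw [← ofReal_integral_eq_lintegral_ofReal
    ((integrable_exp_neg_mul_sq (by norm_num : (0 : ℝ) < 1 / 4)).const_mul _)
    (Filter.Eventually.of_forall fun _ => by positivity), integral_const_mul, integral_gaussian]
  congr 1
  rw [← Real.sqrt_inv, ← Real.sqrt_mul (by positivity)]
  congr 1
  have := Real.pi_pos
  field_simp
  norm_num

/-- Exponential moments of quadratic forms of a subgaussian vector: mixing the linear moment bound
over Gaussian coefficients of orthogonal directions. -/
lemma lintegral_exp_sum_sq_le {n : ℕ} {ι : Type*} {ν : Measure (Fin n → ℝ)} [SFinite ν] {s : ℝ}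
    (hs : 0 < s)
    (hν : ∀ l : Fin n → ℝ, ∫⁻ e, ENNReal.ofReal (Real.exp (l ⬝ᵥ e)) ∂ν ≤
      ENNReal.ofReal (Real.exp (s ^ 2 * (l ⬝ᵥ l) / 2)))
    (u : ι → Fin n → ℝ) (J : Finset ι) (hnorm : ∀ j ∈ J, u j ⬝ᵥ u j ≤ 1)
    (horth : ∀ i ∈ J, ∀ j ∈ J, i ≠ j → u i ⬝ᵥ u j = 0) (l : Fin n → ℝ)
    (hl : ∀ j ∈ J, l ⬝ᵥ u j = 0) :
    ∫⁻ e, ENNReal.ofReal (Real.exp (l ⬝ᵥ e + (∑ j ∈ J, (u j ⬝ᵥ e) ^ 2) / (4 * s ^ 2))) ∂ν ≤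
      ENNReal.ofReal (Real.sqrt 2 ^ J.card * Real.exp (s ^ 2 * (l ⬝ᵥ l) / 2)) := by
  classical
  induction J using Finset.induction_on generalizing l with
  | empty => simpa using hν l
  | @insert j J hj ih =>
    have h2 : Real.sqrt 2 ^ 2 = 2 := Real.sq_sqrt (by norm_num)
    have hs2 : Real.sqrt 2 * s ≠ 0 := by positivity
    have hmeas : Measurable (fun z : (Fin n → ℝ) × ℝ =>
        ENNReal.ofReal (Real.exp ((l + (z.2 / (Real.sqrt 2 * s)) • u j) ⬝ᵥ z.1 +
          (∑ i ∈ J, (u i ⬝ᵥ z.1) ^ 2) / (4 * s ^ 2)))) := by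
      unfold dotProduct
      simp only [Pi.add_apply, Pi.smul_apply, smul_eq_mul]
      fun_prop
    calc ∫⁻ e, ENNReal.ofReal (Real.exp (l ⬝ᵥ e +
          (∑ i ∈ insert j J, (u i ⬝ᵥ e) ^ 2) / (4 * s ^ 2))) ∂ν
        = ∫⁻ e, ∫⁻ g, ENNReal.ofReal (Real.exp ((l + (g / (Real.sqrt 2 * s)) • u j) ⬝ᵥ e +
          (∑ i ∈ J, (u i ⬝ᵥ e) ^ 2) / (4 * s ^ 2)))
            ∂(ProbabilityTheory.gaussianReal 0 1) ∂ν := by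
          -- The square is linearised by `exp(c²/2) = E exp(cg)` with `c = (u j ⬝ᵥ e) / (√2 s)`,
          -- which moves it into the linear part `l`.
          refine lintegral_congr fun e => ?_
          have e1 : ∀ g : ℝ, ENNReal.ofReal (Real.exp ((l + (g / (Real.sqrt 2 * s)) • u j) ⬝ᵥ e +
              (∑ i ∈ J, (u i ⬝ᵥ e) ^ 2) / (4 * s ^ 2))) =
              ENNReal.ofReal (Real.exp (l ⬝ᵥ e + (∑ i ∈ J, (u i ⬝ᵥ e) ^ 2) / (4 * s ^ 2))) *
              ENNReal.ofReal (Real.exp ((u j ⬝ᵥ e / (Real.sqrt 2 * s)) * g)) := by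
            intro g
            rw [← ENNReal.ofReal_mul (Real.exp_pos _).le, ← Real.exp_add, add_dotProduct,
              smul_dotProduct, smul_eq_mul]
            congr 2
            ring
          simp only [e1]
          rw [lintegral_const_mul _ (by fun_prop), lintegral_exp_mul_gaussian,
            ← ENNReal.ofReal_mul (Real.exp_pos _).le, ← Real.exp_add, Finset.sum_insert hj]
          congr 2
          rw [div_pow, mul_pow, h2]
          field_simp
          ring
      _ = ∫⁻ g, ∫⁻ e, ENNReal.ofReal (Real.exp ((l + (g / (Real.sqrt 2 * s)) • u j) ⬝ᵥ e +
          (∑ i ∈ J, (u i ⬝ᵥ e) ^ 2) / (4 * s ^ 2))) ∂ν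
            ∂(ProbabilityTheory.gaussianReal 0 1) :=
          lintegral_lintegral_swap hmeas.aemeasurable
      _ ≤ ∫⁻ g, ENNReal.ofReal (Real.sqrt 2 ^ J.card * Real.exp (s ^ 2 * (l ⬝ᵥ l) / 2)) *
            ENNReal.ofReal (Real.exp (g ^ 2 / 4)) ∂(ProbabilityTheory.gaussianReal 0 1) := by
          -- The shifted `l` is still orthogonal to the remaining directions, so the induction
          -- hypothesis applies. Its squared length grows by at most `g² / (2s²)`, which costs
          -- `exp(g²/4)`, of Gaussian mean `√2`.
          refine lintegral_mono fun g => ?_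
          have hlj : l ⬝ᵥ u j = 0 := hl j (Finset.mem_insert_self _ _)
          refine (ih (fun i hi => hnorm i (Finset.mem_insert_of_mem hi))
            (fun i hi i' hi' => horth i (Finset.mem_insert_of_mem hi) i'
              (Finset.mem_insert_of_mem hi')) _ ?_).trans ?_
          · intro i hi
            rw [add_dotProduct, smul_dotProduct, hl i (Finset.mem_insert_of_mem hi),
              horth j (Finset.mem_insert_self _ _) i (Finset.mem_insert_of_mem hi)
                (fun h => hj (h ▸ hi))]
            simp
          · rw [← ENNReal.ofReal_mul (by positivity), mul_assoc, ← Real.exp_add]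
            gcongr
            have e2 : (l + (g / (Real.sqrt 2 * s)) • u j) ⬝ᵥ (l + (g / (Real.sqrt 2 * s)) • u j) =
                l ⬝ᵥ l + (g / (Real.sqrt 2 * s)) ^ 2 * (u j ⬝ᵥ u j) := by
              simp only [add_dotProduct, dotProduct_add, smul_dotProduct, dotProduct_smul,
                smul_eq_mul, hlj, dotProduct_comm (u j) l]
              ring
            have e3 := hnorm j (Finset.mem_insert_self _ _)
            have e4 : (g / (Real.sqrt 2 * s)) ^ 2 * (u j ⬝ᵥ u j) ≤
                (g / (Real.sqrt 2 * s)) ^ 2 := by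
              nlinarith [sq_nonneg (g / (Real.sqrt 2 * s))]
            have e5 : s ^ 2 * (g / (Real.sqrt 2 * s)) ^ 2 = g ^ 2 / 2 := by
              rw [div_pow, mul_pow, h2]
              field_simp
            have e6 := mul_le_mul_of_nonneg_left e4 (sq_nonneg s)
            rw [e2]
            linarith
      _ = ENNReal.ofReal (Real.sqrt 2 ^ (insert j J).card *
            Real.exp (s ^ 2 * (l ⬝ᵥ l) / 2)) := by
          rw [lintegral_const_mul _ (by fun_prop), lintegral_exp_sq_gaussian,
            ← ENNReal.ofReal_mul (by positivity), Finset.card_insert_of_notMem hj]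
          congr 1
          ring

/-- The normalised direction `v - q v` is adjoined to the orthogonal family as one more vector. If
it vanishes, inverse and quotient are both 0; this is why vectors of norm at most one are allowed.
-/
lemma lintegral_exp_extProj_le {n : ℕ} {ι : Type*} {ν : Measure (Fin n → ℝ)} [SFinite ν] {s : ℝ}
    (hs : 0 < s)
    (hν : ∀ l : Fin n → ℝ, ∫⁻ e, ENNReal.ofReal (Real.exp (l ⬝ᵥ e)) ∂ν ≤
      ENNReal.ofReal (Real.exp (s ^ 2 * (l ⬝ᵥ l) / 2)))
    (u : ι → Fin n → ℝ) (J : Finset ι) (hnorm : ∀ j ∈ J, u j ⬝ᵥ u j ≤ 1)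
    (horth : ∀ i ∈ J, ∀ j ∈ J, i ≠ j → u i ⬝ᵥ u j = 0)
    (q : (Fin n → ℝ) →ₗ[ℝ] (Fin n → ℝ)) (v : Fin n → ℝ)
    (hq : ∀ e, e ⬝ᵥ q e = ∑ j ∈ J, (u j ⬝ᵥ e) ^ 2) (hv : ∀ j ∈ J, u j ⬝ᵥ (v - q v) = 0) :
    ∫⁻ e, ENNReal.ofReal (Real.exp (extProj q v e / (4 * s ^ 2))) ∂ν ≤
      ENNReal.ofReal (Real.sqrt 2 ^ (J.card + 1)) := by
  classical
  set w := v - q v with hw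
  have hww : 0 ≤ w ⬝ᵥ w := dot_self_nonneg w
  set U : Option ι → Fin n → ℝ := fun o => o.elim ((Real.sqrt (w ⬝ᵥ w))⁻¹ • w) u with hU
  have key := lintegral_exp_sum_sq_le hs hν U (Finset.insertNone J) ?_ ?_ 0 (by simp)
  · rw [Finset.card_insertNone] at key
    simp only [zero_dotProduct, mul_zero, zero_div, Real.exp_zero, mul_one, zero_add] at key
    refine le_trans (le_of_eq (lintegral_congr fun e => ?_)) key
    congr 3
    rw [Finset.sum_insertNone]
    simp only [hU, Option.elim, extProj, hq]
    rw [smul_dotProduct, smul_eq_mul, mul_pow, inv_pow, Real.sq_sqrt hww, ← hw,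
      dotProduct_comm w e, add_comm]
    congr 1
    rw [div_eq_inv_mul]
  · intro o ho
    cases o with
    | none =>
      simp only [hU, Option.elim, smul_dotProduct, dotProduct_smul, smul_eq_mul]
      rw [← mul_assoc, ← mul_inv, Real.mul_self_sqrt hww]
      exact inv_mul_le_one
    | some j => exact hnorm j (Finset.some_mem_insertNone.1 ho)
  · intro o ho o' ho' hne
    cases o with
    | none =>
      cases o' with
      | none => exact absurd rfl hne
      | some j =>
        simp only [hU, Option.elim, smul_dotProduct]
        rw [dotProduct_comm w (u j), hv j (Finset.some_mem_insertNone.1 ho'), smul_zero]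
    | some i =>
      cases o' with
      | none =>
        simp only [hU, Option.elim, dotProduct_smul]
        rw [hv i (Finset.some_mem_insertNone.1 ho), smul_zero]
      | some j =>
        exact horth i (Finset.some_mem_insertNone.1 ho) j (Finset.some_mem_insertNone.1 ho')
          (fun h => hne (congrArg some h))

/-- The normalised indicator of a set of indices. -/
noncomputable def unitInd {n : ℕ} (b : Finset (Fin n)) : Fin n → ℝ :=
  fun i => if i ∈ b then (Real.sqrt b.card)⁻¹ else 0

lemma unitInd_dot {n : ℕ} (b : Finset (Fin n)) (v : Fin n → ℝ) :
    unitInd b ⬝ᵥ v = (Real.sqrt b.card)⁻¹ * ∑ i ∈ b, v i := by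
  simp [unitInd, dotProduct, Finset.mul_sum]

lemma filter_cls_eq {n : ℕ} {r : Fin n → Fin n → Prop} (hr : Equivalence r)
    {b : Finset (Fin n)} (hb : b ∈ classes r) : Finset.univ.filter (fun i => cls r i = b) = b := by
  obtain ⟨i0, -, rfl⟩ := Finset.mem_image.1 hb
  ext i
  simp only [Finset.mem_filter, Finset.mem_univ, true_and]
  constructor
  · exact fun h => h ▸ mem_cls.2 (hr.refl i)
  · exact fun h => (cls_eq_of_rel hr (mem_cls.1 h)).symm

lemma cls_eq_of_mem {n : ℕ} {r : Fin n → Fin n → Prop} (hr : Equivalence r)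
    {b : Finset (Fin n)} (hb : b ∈ classes r) {i : Fin n} (hi : i ∈ b) : cls r i = b := by
  rw [← filter_cls_eq hr hb] at hi
  exact (Finset.mem_filter.1 hi).2

lemma card_pos_of_mem_classes {n : ℕ} {r : Fin n → Fin n → Prop} (hr : Equivalence r)
    {b : Finset (Fin n)} (hb : b ∈ classes r) : 0 < b.card := by
  obtain ⟨i0, -, rfl⟩ := Finset.mem_image.1 hb
  exact card_cls_pos hr i0

lemma dot_avg_eq_sum {n : ℕ} {r : Fin n → Fin n → Prop} (hr : Equivalence r) (e : Fin n → ℝ) :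
    e ⬝ᵥ avg r e = ∑ b ∈ classes r, (unitInd b ⬝ᵥ e) ^ 2 := by
  classical
  rw [dotProduct, ← Finset.sum_fiberwise_of_maps_to (s := Finset.univ) (t := classes r)
    (g := cls r) (fun i _ => Finset.mem_image_of_mem _ (Finset.mem_univ i))]
  refine Finset.sum_congr rfl fun b hb => ?_
  have h1 : ∀ i ∈ b, e i * avg r e i = e i * ((∑ i ∈ b, e i) / b.card) := by
    intro i hi
    rw [avg_apply, cls_eq_of_mem hr hb hi]
  rw [filter_cls_eq hr hb, Finset.sum_congr rfl h1, ← Finset.sum_mul, unitInd_dot, mul_pow,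
    inv_pow, Real.sq_sqrt (Nat.cast_nonneg _)]
  ring

/-- Exponential moments of the projection onto a partition and one further direction. -/
lemma lintegral_exp_extProj_avg_le {n : ℕ} {ν : Measure (Fin n → ℝ)} [SFinite ν] {s : ℝ}
    (hs : 0 < s)
    (hν : ∀ l : Fin n → ℝ, ∫⁻ e, ENNReal.ofReal (Real.exp (l ⬝ᵥ e)) ∂ν ≤
      ENNReal.ofReal (Real.exp (s ^ 2 * (l ⬝ᵥ l) / 2)))
    {r : Fin n → Fin n → Prop} (hr : Equivalence r) (v : Fin n → ℝ) :
    ∫⁻ e, ENNReal.ofReal (Real.exp (extProj (avg r) v e / (4 * s ^ 2))) ∂ν ≤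
      ENNReal.ofReal (Real.sqrt 2 ^ ((classes r).card + 1)) := by
  refine lintegral_exp_extProj_le hs hν unitInd (classes r) (fun b hb => ?_)
    (fun b hb b' hb' hne => ?_) (avg r) v (dot_avg_eq_sum hr) (fun b hb => ?_)
  · rw [unitInd_dot, Finset.sum_congr rfl (g := fun _ => (Real.sqrt b.card)⁻¹)
      (fun i hi => by simp [unitInd, hi]), Finset.sum_const, nsmul_eq_mul,
      mul_left_comm, ← mul_inv, Real.mul_self_sqrt (Nat.cast_nonneg _)]
    exact mul_inv_le_one
  · rw [unitInd_dot, Finset.sum_eq_zero, mul_zero]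
    intro i hi
    rw [unitInd, if_neg]
    intro hi'
    exact hne ((cls_eq_of_mem hr hb hi).symm.trans (cls_eq_of_mem hr hb' hi'))
  · have h1 : ∀ i ∈ b, avg r v i = (∑ i ∈ b, v i) / b.card := by
      intro i hi
      rw [avg_apply, cls_eq_of_mem hr hb hi]
    have h2 := card_pos_of_mem_classes hr hb
    rw [dotProduct_sub, unitInd_dot, unitInd_dot, Finset.sum_congr rfl h1, Finset.sum_const,
      nsmul_eq_mul]
    field_simp
    ring

lemma lintegral_exp_extProj_zero_le {n : ℕ} {ν : Measure (Fin n → ℝ)} [SFinite ν] {s : ℝ}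
    (hs : 0 < s)
    (hν : ∀ l : Fin n → ℝ, ∫⁻ e, ENNReal.ofReal (Real.exp (l ⬝ᵥ e)) ∂ν ≤
      ENNReal.ofReal (Real.exp (s ^ 2 * (l ⬝ᵥ l) / 2))) (v : Fin n → ℝ) :
    ∫⁻ e, ENNReal.ofReal (Real.exp (extProj 0 v e / (4 * s ^ 2))) ∂ν ≤
      ENNReal.ofReal (Real.sqrt 2) := by
  simpa using lintegral_exp_extProj_le hs hν (ι := Empty) (fun _ => 0) ∅ (by simp) (by simp) 0 v
    (by simp) (by simp)

/-! ### The conditional law of the noise -/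

open ProbabilityTheory in
/-- The conditional law of the noise given the design is almost surely subgaussian. -/
lemma ae_condDistrib_le {Ω : Type*} [MeasurableSpace Ω] {μ : Measure Ω} [IsProbabilityMeasure μ]
    {n d : ℕ} (hn : 1 ≤ n) {X : Ω → Fin n → Fin d → ℝ} (hX : Measurable X)
    {ε : Ω → Fin n → ℝ} (hε : Measurable ε) {s : ℝ} (hsub : SubgaussianNoise μ X ε s) :
    ∀ᵐ ω ∂μ, ∀ l : Fin n → ℝ,
      ∫⁻ e, ENNReal.ofReal (Real.exp (l ⬝ᵥ e)) ∂(condDistrib ε X μ (X ω)) ≤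
        ENNReal.ofReal (Real.exp (s ^ 2 * (l ⬝ᵥ l) / 2)) := by
  have hn0 : (n : ℝ) ≠ 0 := by positivity
  have hmeas : ∀ l : Fin n → ℝ, Measurable fun e : Fin n → ℝ => Real.exp (l ⬝ᵥ e) := by
    intro l
    unfold dotProduct
    fun_prop
  have hone : ∀ l : Fin n → ℝ, ∀ᵐ ω ∂μ,
      ∫⁻ e, ENNReal.ofReal (Real.exp (l ⬝ᵥ e)) ∂(condDistrib ε X μ (X ω)) ≤
        ENNReal.ofReal (Real.exp (s ^ 2 * (l ⬝ᵥ l) / 2)) := by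
    intro l
    -- The factor `n` undoes the normalisation of the empirical scalar product.
    obtain ⟨h1, h2⟩ := hsub ((n : ℝ) • l)
    have e1 : ∀ e : Fin n → ℝ, empInner ((n : ℝ) • l) e = l ⬝ᵥ e := by
      intro e
      have : ∀ i, ((n : ℝ) • l) i * e i = n * (l i * e i) := fun i => by
        simp [mul_assoc]
      rw [empInner, Finset.sum_congr rfl fun i _ => this i, ← Finset.mul_sum,
        mul_div_cancel_left₀ _ hn0, dotProduct]
    have e2 : empNorm ((n : ℝ) • l) ^ 2 * s ^ 2 / (2 * n) = s ^ 2 * (l ⬝ᵥ l) / 2 := by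
      have : 0 ≤ l ⬝ᵥ ((n : ℝ) • l) := by
        rw [dotProduct_smul]
        exact mul_nonneg (Nat.cast_nonneg n) (dot_self_nonneg l)
      rw [empNorm, e1, Real.sq_sqrt this, dotProduct_smul, smul_eq_mul]
      field_simp
    simp only [e1, e2] at h1 h2
    have h3 := condExp_ae_eq_integral_condDistrib hX hε.aemeasurable
      (hmeas l).stronglyMeasurable h1
    have h4 : Integrable (fun z : (Fin n → Fin d → ℝ) × (Fin n → ℝ) => Real.exp (l ⬝ᵥ z.2))
        (μ.map fun ω => (X ω, ε ω)) := by
      exact (integrable_map_measure ((hmeas l).comp measurable_snd).aestronglyMeasurable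
        (hX.prodMk hε).aemeasurable).2 h1
    have h5 := h4.condDistrib_ae hX.aemeasurable hε.aemeasurable
    filter_upwards [h2, h3, h5] with ω h6 h7 h8
    rw [h7] at h6
    rw [← ofReal_integral_eq_lintegral_ofReal h8
      (Filter.Eventually.of_forall fun _ => (Real.exp_pos _).le)]
    exact ENNReal.ofReal_le_ofReal h6
  -- The exceptional null set depends on `l`, so a countable dense set of directions is used;
  -- Fatou's lemma then extends the bound to every `l`.
  have hall : ∀ᵐ ω ∂μ, ∀ j : ℕ,
      ∫⁻ e, ENNReal.ofReal (Real.exp (TopologicalSpace.denseSeq (Fin n → ℝ) j ⬝ᵥ e))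
        ∂(condDistrib ε X μ (X ω)) ≤
      ENNReal.ofReal (Real.exp (s ^ 2 * (TopologicalSpace.denseSeq (Fin n → ℝ) j ⬝ᵥ
        TopologicalSpace.denseSeq (Fin n → ℝ) j) / 2)) := ae_all_iff.2 fun j => hone _
  filter_upwards [hall] with ω hω l
  obtain ⟨u, hu, hlim⟩ := mem_closure_iff_seq_limit.1
    ((TopologicalSpace.denseRange_denseSeq (Fin n → ℝ)) l)
  have hdot : Continuous fun z : (Fin n → ℝ) × (Fin n → ℝ) => z.1 ⬝ᵥ z.2 := by
    unfold dotProduct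
    fun_prop
  have hl1 : ∀ e : Fin n → ℝ, Filter.Tendsto (fun j => ENNReal.ofReal (Real.exp (u j ⬝ᵥ e)))
      Filter.atTop (nhds (ENNReal.ofReal (Real.exp (l ⬝ᵥ e)))) := fun e =>
    (ENNReal.continuous_ofReal.comp (Real.continuous_exp.comp
      (hdot.comp (Continuous.prodMk_left e)))).continuousAt.tendsto.comp hlim
  have hl2 : Filter.Tendsto (fun j => ENNReal.ofReal (Real.exp (s ^ 2 * (u j ⬝ᵥ u j) / 2)))
      Filter.atTop (nhds (ENNReal.ofReal (Real.exp (s ^ 2 * (l ⬝ᵥ l) / 2)))) := by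
    have hc : Continuous fun v : Fin n → ℝ =>
        ENNReal.ofReal (Real.exp (s ^ 2 * (v ⬝ᵥ v) / 2)) := by
      unfold dotProduct
      exact ENNReal.continuous_ofReal.comp (by fun_prop)
    exact hc.continuousAt.tendsto.comp hlim
  calc ∫⁻ e, ENNReal.ofReal (Real.exp (l ⬝ᵥ e)) ∂(condDistrib ε X μ (X ω))
      = ∫⁻ e, Filter.liminf (fun j => ENNReal.ofReal (Real.exp (u j ⬝ᵥ e))) Filter.atTop
        ∂(condDistrib ε X μ (X ω)) := lintegral_congr fun e => (hl1 e).liminf_eq.symm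
    _ ≤ Filter.liminf (fun j => ∫⁻ e, ENNReal.ofReal (Real.exp (u j ⬝ᵥ e))
        ∂(condDistrib ε X μ (X ω))) Filter.atTop :=
      lintegral_liminf_le fun j => (hmeas (u j)).ennreal_ofReal
    _ ≤ Filter.liminf (fun j => ENNReal.ofReal (Real.exp (s ^ 2 * (u j ⬝ᵥ u j) / 2)))
        Filter.atTop := by
      refine Filter.liminf_le_liminf (Filter.Eventually.of_forall fun j => ?_)
      obtain ⟨i, hi⟩ := hu j
      rw [← hi]
      exact hω i
    _ = ENNReal.ofReal (Real.exp (s ^ 2 * (l ⬝ᵥ l) / 2)) := hl2.liminf_eq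

/-! ### Measurability -/

lemma measurable_avg {α : Type*} [MeasurableSpace α] {n : ℕ} {r : α → Fin n → Fin n → Prop}
    (hr : ∀ i i', MeasurableSet {a | r a i i'}) {v : α → Fin n → ℝ} (hv : Measurable v) :
    Measurable fun a => avg (r a) (v a) := by
  classical
  refine measurable_pi_iff.2 fun i => ?_
  have h1 : ∀ a, avg (r a) (v a) i =
      (∑ i', if r a i i' then v a i' else 0) / ∑ i', if r a i i' then (1 : ℝ) else 0 := by
    intro a
    simp [avg_apply, cls, Finset.sum_filter]
  simp only [h1]
  refine Measurable.div (Finset.measurable_sum _ fun i' _ => ?_)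
    (Finset.measurable_sum _ fun i' _ => ?_)
  · exact Measurable.ite (hr i i') ((measurable_pi_apply i').comp hv) measurable_const
  · exact Measurable.ite (hr i i') measurable_const measurable_const

lemma measurable_dot {α : Type*} [MeasurableSpace α] {n : ℕ} {v w : α → Fin n → ℝ}
    (hv : Measurable v) (hw : Measurable w) : Measurable fun a => v a ⬝ᵥ w a := by
  unfold dotProduct
  fun_prop

lemma measurable_extProj {α : Type*} [MeasurableSpace α] {n : ℕ}
    {q : α → (Fin n → ℝ) →ₗ[ℝ] (Fin n → ℝ)}
    (hq : ∀ v : α → Fin n → ℝ, Measurable v → Measurable fun a => q a (v a))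
    {v e : α → Fin n → ℝ} (hv : Measurable v) (he : Measurable e) :
    Measurable fun a => extProj (q a) (v a) (e a) := by
  have h1 := measurable_dot he (hq e he)
  have h2 := hv.sub (hq v hv)
  have h3 := measurable_dot he h2
  have h4 := measurable_dot h2 h2
  exact h1.add ((h3.pow_const 2).div h4)

lemma measurable_extProj_avg {α : Type*} [MeasurableSpace α] {n : ℕ}
    {r : α → Fin n → Fin n → Prop} (hr : ∀ i i', MeasurableSet {a | r a i i'})
    {v e : α → Fin n → ℝ} (hv : Measurable v) (he : Measurable e) :
    Measurable fun a => extProj (avg (r a)) (v a) (e a) :=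
  measurable_extProj (q := fun a : α => avg (r a)) (fun _ hw => measurable_avg hr hw) hv he

lemma measurableSet_decode {n d : ℕ} (l : List (Fin d × Fin n)) (i i' : Fin n) :
    MeasurableSet {x : Fin n → Fin d → ℝ | decode x l i i'} := by
  induction l generalizing i i' with
  | nil => simp [decode]
  | cons q l ih =>
    have hlt : ∀ i : Fin n, MeasurableSet {x : Fin n → Fin d → ℝ | x i q.1 < x q.2 q.1} :=
      fun i => measurableSet_lt (by fun_prop) (by fun_prop)
    exact (ih i i').inter ((ih q.2 i).imp ((hlt i).iff (hlt i')))

/-! ### The deviation functional -/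

/-- A sum of exponentials dominating the deviations of all extended projections over all
partitions of the design that can be reached by splitting. -/
noncomputable def devSum {n d : ℕ} (s L : ℝ) (x : Fin n → Fin d → ℝ) (v e : Fin n → ℝ) : ℝ :=
  Real.exp (extProj 0 v e / (4 * s ^ 2)) +
    ∑ m ∈ Finset.range n, ∑ c : Fin m → Fin d × Fin n,
      Real.exp (-(3 / 2 * L * (m + 1))) *
        Real.exp (extProj (avg (decode x (List.ofFn c))) v e / (4 * s ^ 2))

lemma devSum_nonneg {n d : ℕ} (s L : ℝ) (x : Fin n → Fin d → ℝ) (v e : Fin n → ℝ) :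
    0 ≤ devSum s L x v e := by
  unfold devSum
  positivity

/-- Bounding the logarithm linearly, `u ≤ exp(u) / e ≤ D / 2`, keeps `D` itself, so that a
first-moment bound on `D` is enough. -/
lemma le_of_exp_le {s L k M D : ℝ} (hs : 0 < s)
    (h : Real.exp (-(3 / 2 * L * k)) * Real.exp (M / (4 * s ^ 2)) ≤ D) :
    M ≤ 6 * L * s ^ 2 * k + 2 * s ^ 2 * D := by
  rw [← Real.exp_add] at h
  have h1 := Real.add_one_le_exp (-(3 / 2 * L * k) + M / (4 * s ^ 2) - 1)
  rw [Real.exp_sub] at h1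
  have h2 : (2 : ℝ) ≤ Real.exp 1 := by
    have := Real.add_one_le_exp (1 : ℝ)
    linarith
  have h3 : Real.exp (-(3 / 2 * L * k) + M / (4 * s ^ 2)) / Real.exp 1 ≤ D / 2 := by
    have := (Real.exp_pos (-(3 / 2 * L * k) + M / (4 * s ^ 2))).le.trans h
    gcongr
  have h4 : M / (4 * s ^ 2) ≤ 3 / 2 * L * k + D / 2 := by linarith
  rw [div_le_iff₀ (by positivity)] at h4
  linarith

/-- However the tree depends on the data, its relation at each positive generation equals `decode x
l` for some list `l`, and its term is one summand of `devSum`. Generation 0 is covered by the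
separate first term. -/
lemma IsGrownTree.extProj_le {n d : ℕ} {x : Fin n → Fin d → ℝ} {y : Fin n → ℝ}
    {P : ℕ → Set (Set (Fin d → ℝ))} {rule : GrowthRule} (h : IsGrownTree rule x y P)
    (hn : 1 ≤ n) {s : ℝ} (hs : 0 < s) (L : ℝ) (v e : Fin n → ℝ) (g : ℕ) :
    extProj (avg (rel x (P g))) v e ≤
      6 * L * s ^ 2 * (P g).ncard + 2 * s ^ 2 * devSum s L x v e := by
  have hpos : 0 ≤ ∑ m ∈ Finset.range n, ∑ c : Fin m → Fin d × Fin n,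
      Real.exp (-(3 / 2 * L * (m + 1))) *
        Real.exp (extProj (avg (decode x (List.ofFn c))) v e / (4 * s ^ 2)) := by positivity
  refine le_of_exp_le hs ?_
  rcases g with _ | g
  · rw [avg_eq_zero h.rel_zero, h.1, Set.ncard_empty]
    simp only [Nat.cast_zero, mul_zero, neg_zero, Real.exp_zero, one_mul]
    exact le_add_of_nonneg_right hpos
  · obtain ⟨m, hm⟩ := h.exists_reach hn g
    obtain ⟨l, rfl, hrel⟩ := hm.exists_decode
    have hlt : l.length < n := hm.succ_le hn
    rw [hm.finite_ncard.2, hrel]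
    have h1 : Real.exp (-(3 / 2 * L * ((l.length : ℝ) + 1))) *
        Real.exp (extProj (avg (decode x l)) v e / (4 * s ^ 2)) ≤
        ∑ c : Fin l.length → Fin d × Fin n, Real.exp (-(3 / 2 * L * ((l.length : ℝ) + 1))) *
        Real.exp (extProj (avg (decode x (List.ofFn c))) v e / (4 * s ^ 2)) := by
      have := Finset.single_le_sum (f := fun c : Fin l.length → Fin d × Fin n =>
        Real.exp (-(3 / 2 * L * ((l.length : ℝ) + 1))) *
        Real.exp (extProj (avg (decode x (List.ofFn c))) v e / (4 * s ^ 2)))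
        (fun c _ => by positivity) (Finset.mem_univ l.get)
      simpa only [List.ofFn_get] using this
    have h2 := Finset.single_le_sum (f := fun m : ℕ => ∑ c : Fin m → Fin d × Fin n,
      Real.exp (-(3 / 2 * L * ((m : ℝ) + 1))) *
        Real.exp (extProj (avg (decode x (List.ofFn c))) v e / (4 * s ^ 2)))
        (fun m _ => by positivity) (Finset.mem_range.2 hlt)
    have h3 := Real.exp_pos (extProj 0 v e / (4 * s ^ 2))
    push_cast
    unfold devSum
    linarith [h1.trans h2]

lemma measurable_devSum {n d : ℕ} (s L : ℝ) {v : (Fin n → Fin d → ℝ) → Fin n → ℝ}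
    (hv : Measurable v) :
    Measurable fun z : (Fin n → Fin d → ℝ) × (Fin n → ℝ) => devSum s L z.1 (v z.1) z.2 := by
  have hv' : Measurable fun z : (Fin n → Fin d → ℝ) × (Fin n → ℝ) => v z.1 :=
    hv.comp measurable_fst
  have h0 : Measurable fun z : (Fin n → Fin d → ℝ) × (Fin n → ℝ) => extProj 0 (v z.1) z.2 :=
    measurable_extProj (q := fun _ : (Fin n → Fin d → ℝ) × (Fin n → ℝ) => 0)
      (fun _ _ => measurable_const) hv' measurable_snd
  have h1 : ∀ l, Measurable fun z : (Fin n → Fin d → ℝ) × (Fin n → ℝ) =>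
      extProj (avg (decode z.1 l)) (v z.1) z.2 := fun l =>
    measurable_extProj_avg (fun i i' => measurable_fst (measurableSet_decode l i i')) hv'
      measurable_snd
  exact (h0.div_const _).exp.add (Finset.measurable_sum _ fun m _ =>
    Finset.measurable_sum _ fun c _ => ((h1 _).div_const _).exp.const_mul _)

/-- With `D = (d ∨ 2)n`, the weight `D^(-3(m+1)/2)` pays `D^m` for the number of lists and `D^(m/2)`
for the moment `√2^m`, leaving `2 D^(-3/2) ≤ 1/n` per term. So the sum is at most 1, and `√2 + 1 ≤ 4
log 2`. -/
lemma sum_weights_le {n d : ℕ} (hn : 1 ≤ n) :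
    Real.sqrt 2 + ∑ m ∈ Finset.range n, ((d * n : ℕ) : ℝ) ^ m *
      (Real.exp (-(3 / 2 * Real.log (max (d : ℝ) 2 * n) * (m + 1))) * Real.sqrt 2 ^ (m + 2)) ≤
      4 * Real.log (max (d : ℝ) 2 * n) := by
  set D := max (d : ℝ) 2 * n with hD
  have hn1 : (1 : ℝ) ≤ n := by exact_mod_cast hn
  have hD2n : 2 * (n : ℝ) ≤ D := mul_le_mul_of_nonneg_right (le_max_right _ _) (by linarith)
  have hDdn : ((d * n : ℕ) : ℝ) ≤ D := by
    push_cast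
    exact mul_le_mul_of_nonneg_right (le_max_left _ _) (by linarith)
  have hD2 : 2 ≤ D := by linarith
  have hDpos : 0 < D := by linarith
  set a := Real.sqrt D with ha
  have haD : a ^ 2 = D := Real.sq_sqrt hDpos.le
  have ha2 : Real.sqrt 2 ≤ a := Real.sqrt_le_sqrt hD2
  have hsq2 : Real.sqrt 2 ^ 2 = 2 := Real.sq_sqrt (by norm_num)
  have hs1 : 1 ≤ Real.sqrt 2 := Real.one_le_sqrt.2 (by norm_num)
  have ha1 : 1 ≤ a := hs1.trans ha2
  have hterm : ∀ m : ℕ, ((d * n : ℕ) : ℝ) ^ m *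
      (Real.exp (-(3 / 2 * Real.log D * (m + 1))) * Real.sqrt 2 ^ (m + 2)) ≤ 1 / n := by
    intro m
    have e1 : Real.exp (-(3 / 2 * Real.log D * (m + 1))) = ((a ^ 3) ^ (m + 1))⁻¹ := by
      have hlog : Real.log D = 2 * Real.log a := by rw [← haD, Real.log_pow]; norm_num
      rw [Real.exp_neg, hlog]
      congr 1
      rw [← Real.exp_log (show 0 < (a ^ 3) ^ (m + 1) by positivity), Real.log_pow, Real.log_pow]
      congr 1
      push_cast
      ring
    rw [e1]
    calc ((d * n : ℕ) : ℝ) ^ m * (((a ^ 3) ^ (m + 1))⁻¹ * Real.sqrt 2 ^ (m + 2))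
        ≤ (a ^ 2) ^ m * (((a ^ 3) ^ (m + 1))⁻¹ * (a ^ m * 2)) := by
          rw [pow_add (Real.sqrt 2), hsq2]
          gcongr
          rw [haD]
          exact hDdn
      _ = 2 / (a ^ 2 * a) := by
          field_simp
          ring
      _ ≤ 2 / (a ^ 2 * 1) := by gcongr
      _ ≤ 2 / (2 * n) := by rw [mul_one, haD]; gcongr
      _ = 1 / n := by field_simp
  have hsum := Finset.sum_le_sum fun m (_ : m ∈ Finset.range n) => hterm m
  rw [Finset.sum_const, Finset.card_range, nsmul_eq_mul, mul_one_div_cancel (by positivity)]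
    at hsum
  have hlog2 : Real.log 2 ≤ Real.log D := Real.log_le_log (by norm_num) hD2
  have := Real.log_two_gt_d9
  have hs3 : Real.sqrt 2 ≤ 3 / 2 := by
    rw [Real.sqrt_le_left (by norm_num)]
    norm_num
  linarith

set_option maxHeartbeats 1000000 in
lemma lintegral_devSum_le_of_forall {n d : ℕ} (hn : 1 ≤ n) {ν : Measure (Fin n → ℝ)} [SFinite ν]
    {s : ℝ} (hs : 0 < s)
    (hω : ∀ l : Fin n → ℝ, ∫⁻ e, ENNReal.ofReal (Real.exp (l ⬝ᵥ e)) ∂ν ≤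
      ENNReal.ofReal (Real.exp (s ^ 2 * (l ⬝ᵥ l) / 2))) (x : Fin n → Fin d → ℝ) (w : Fin n → ℝ) :
    ∫⁻ e, ENNReal.ofReal (devSum s (Real.log (max (d : ℝ) 2 * n)) x w e) ∂ν ≤
      ENNReal.ofReal (4 * Real.log (max (d : ℝ) 2 * n)) := by
  set L := Real.log (max (d : ℝ) 2 * n) with hL
  have hm0 : Measurable fun e => extProj 0 w e :=
    measurable_extProj (q := fun _ : Fin n → ℝ => 0) (fun _ _ => measurable_const)
      measurable_const measurable_id
  have hm1 : ∀ l, Measurable fun e => extProj (avg (decode x l)) w e := fun l =>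
    measurable_extProj_avg (r := fun _ : Fin n → ℝ => decode x l)
      (fun i i' => MeasurableSet.const _) measurable_const measurable_id
  have hE0 : Measurable fun e => ENNReal.ofReal (Real.exp (extProj 0 w e / (4 * s ^ 2))) :=
    (hm0.div_const _).exp.ennreal_ofReal
  have hE1 : ∀ l, Measurable fun e =>
      ENNReal.ofReal (Real.exp (extProj (avg (decode x l)) w e / (4 * s ^ 2))) := fun l =>
    ((hm1 l).div_const _).exp.ennreal_ofReal
  have hexp : ∀ e, ENNReal.ofReal (devSum s L x w e) =
      ENNReal.ofReal (Real.exp (extProj 0 w e / (4 * s ^ 2))) +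
      ∑ m ∈ Finset.range n, ∑ c : Fin m → Fin d × Fin n,
        ENNReal.ofReal (Real.exp (-(3 / 2 * L * (m + 1)))) * ENNReal.ofReal
          (Real.exp (extProj (avg (decode x (List.ofFn c))) w e / (4 * s ^ 2))) := by
    intro e
    rw [devSum, ENNReal.ofReal_add (by positivity) (by positivity),
      ENNReal.ofReal_sum_of_nonneg fun m _ => by positivity]
    congr 1
    refine Finset.sum_congr rfl fun m _ => ?_
    rw [ENNReal.ofReal_sum_of_nonneg fun c _ => by positivity]
    exact Finset.sum_congr rfl fun c _ => ENNReal.ofReal_mul (Real.exp_pos _).le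
  simp only [hexp]
  rw [lintegral_add_left hE0, lintegral_finsetSum _ (fun m _ => Finset.measurable_sum _
    fun c _ => (hE1 _).const_mul _)]
  refine le_trans ?_ (ENNReal.ofReal_le_ofReal (sum_weights_le (d := d) hn))
  rw [ENNReal.ofReal_add (by positivity) (by positivity),
    ENNReal.ofReal_sum_of_nonneg fun m _ => by positivity]
  refine add_le_add (lintegral_exp_extProj_zero_le hs hω w) (Finset.sum_le_sum fun m _ => ?_)
  rw [lintegral_finsetSum _ (fun c _ => (hE1 _).const_mul _)]
  have hc : ∀ c : Fin m → Fin d × Fin n,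
      ∫⁻ e, ENNReal.ofReal (Real.exp (-(3 / 2 * L * (m + 1)))) * ENNReal.ofReal
        (Real.exp (extProj (avg (decode x (List.ofFn c))) w e / (4 * s ^ 2)))
          ∂ν ≤
        ENNReal.ofReal (Real.exp (-(3 / 2 * L * (m + 1))) * Real.sqrt 2 ^ (m + 2)) := by
    intro c
    rw [lintegral_const_mul _ (hE1 _), ENNReal.ofReal_mul (Real.exp_pos _).le]
    gcongr
    refine (lintegral_exp_extProj_avg_le hs hω (equivalence_decode x _) w).trans
      (ENNReal.ofReal_le_ofReal (pow_le_pow_right₀ (Real.one_le_sqrt.2 (by norm_num)) ?_))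
    -- A list of `m` cuts gives at most `m + 1` classes; the direction of the bias adds one more
    -- dimension.
    have := card_classes_decode x (List.ofFn c)
    rw [List.length_ofFn] at this
    omega
  refine (Finset.sum_le_sum fun c _ => hc c).trans ?_
  rw [Finset.sum_const, Finset.card_univ, Fintype.card_fun, Fintype.card_prod,
    Fintype.card_fin, Fintype.card_fin, Fintype.card_fin, nsmul_eq_mul,
    ENNReal.ofReal_mul (show (0 : ℝ) ≤ ((d * n : ℕ) : ℝ) ^ m by positivity),
    ENNReal.ofReal_pow (Nat.cast_nonneg _),
    ENNReal.ofReal_natCast, Nat.cast_pow]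

-- Disintegrating along the design freezes both the candidate partitions and the vector `v (X ω)`;
-- the noise then follows a subgaussian law and the fixed-design bound applies.
open ProbabilityTheory in
lemma lintegral_devSum_le {Ω : Type*} [MeasurableSpace Ω] {μ : Measure Ω}
    [IsProbabilityMeasure μ] {n d : ℕ} (hn : 1 ≤ n) {X : Ω → Fin n → Fin d → ℝ}
    (hX : Measurable X) {ε : Ω → Fin n → ℝ} (hε : Measurable ε) {s : ℝ} (hs : 0 < s)
    (hsub : SubgaussianNoise μ X ε s) {v : (Fin n → Fin d → ℝ) → Fin n → ℝ}
    (hv : Measurable v) :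
    ∫⁻ ω, ENNReal.ofReal
        (devSum s (Real.log (max (d : ℝ) 2 * n)) (X ω) (v (X ω)) (ε ω)) ∂μ ≤
      ENNReal.ofReal (4 * Real.log (max (d : ℝ) 2 * n)) := by
  set L := Real.log (max (d : ℝ) 2 * n) with hL
  have hmeas := (measurable_devSum s L hv).ennreal_ofReal
  have h1 : ∫⁻ ω, ENNReal.ofReal (devSum s L (X ω) (v (X ω)) (ε ω)) ∂μ =
      ∫⁻ ω, ∫⁻ e, ENNReal.ofReal (devSum s L (X ω) (v (X ω)) e)
        ∂(condDistrib ε X μ (X ω)) ∂μ := by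
    have e1 := lintegral_map (μ := μ) hmeas (hX.prodMk hε)
    rw [← compProd_map_condDistrib hε.aemeasurable, Measure.lintegral_compProd hmeas,
      lintegral_map hmeas.lintegral_kernel_prod_right' hX] at e1
    exact e1.symm
  rw [h1]
  have h2 : ∀ᵐ ω ∂μ, ∫⁻ e, ENNReal.ofReal (devSum s L (X ω) (v (X ω)) e)
      ∂(condDistrib ε X μ (X ω)) ≤ ENNReal.ofReal (4 * L) := by
    filter_upwards [ae_condDistrib_le hn hX hε hsub] with ω hω
    exact lintegral_devSum_le_of_forall hn hs hω (X ω) (v (X ω))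
  calc _ ≤ ∫⁻ _, ENNReal.ofReal (4 * L) ∂μ := lintegral_mono_ae h2
    _ = ENNReal.ofReal (4 * L) := by simp

lemma empNorm_sq {n : ℕ} (v : Fin n → ℝ) : empNorm v ^ 2 = (v ⬝ᵥ v) / n :=
  Real.sq_sqrt (div_nonneg (dot_self_nonneg v) (Nat.cast_nonneg n))

lemma empNorm_le_iff {n : ℕ} (hn : 1 ≤ n) (v w : Fin n → ℝ) :
    empNorm v ≤ empNorm w ↔ v ⬝ᵥ v ≤ w ⬝ᵥ w := by
  have hn0 : (0 : ℝ) < n := by exact_mod_cast hn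
  rw [← div_le_div_iff_of_pos_right (a := v ⬝ᵥ v) hn0]
  exact Real.sqrt_le_sqrt_iff (div_nonneg (dot_self_nonneg w) hn0.le)

/-! ### Stopping times and oracles on a grown tree -/

namespace IsChain

variable {n : ℕ} {p : ℕ → (Fin n → ℝ) →ₗ[ℝ] (Fin n → ℝ)} {k : ℕ → ℕ}

lemma continuous_oracle (hc : IsChain p k) (F e : Fin n → ℝ) :
    Continuous fun t => empNorm (F - spec p k t F) ^ 2 + empNorm (spec p k t e) ^ 2 := by
  simp only [empNorm_sq]
  exact ((hc.continuous_sub_spec_dot F).div_const _).add ((hc.continuous_spec_dot e).div_const _)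

end IsChain

namespace IsGrownTree

variable {n d : ℕ} {x : Fin n → Fin d → ℝ} {y : Fin n → ℝ} {P : ℕ → Set (Set (Fin d → ℝ))}
  {rule : GrowthRule}

lemma stopTime_spec (h : IsGrownTree rule x y P) (hn : 1 ≤ n) (v : Fin n → ℝ) {κ : ℝ}
    (hκ : 0 ≤ κ) :
    let R := fun t => (v - spec (fun g => avg (rel x (P g))) (fun g => (P g).ncard) t v) ⬝ᵥ
      (v - spec (fun g => avg (rel x (P g))) (fun g => (P g).ncard) t v)
    stopTime x P v κ ∈ Set.Icc (0 : ℝ) n ∧ R (stopTime x P v κ) ≤ n * κ ∧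
      (0 < stopTime x P v κ → R (stopTime x P v κ) = n * κ) ∧
      ∀ a, 0 ≤ a → (stopTime x P v κ ≤ a ↔ R a ≤ n * κ) := by
  intro R
  have hc := h.isChain hn
  have hn0 : (0 : ℝ) < n := by exact_mod_cast hn
  have h1 : Continuous fun t => R t - n * κ :=
    (hc.continuous_sub_spec_dot v).sub continuous_const
  have h2 : Antitone fun t => R t - n * κ := fun s t hst =>
    sub_le_sub_right (hc.sub_spec_dot_anti v hst) _
  have h3 : R n - n * κ ≤ 0 := by
    simp only [R, hc.spec_last hn, sub_self, dotProduct_zero]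
    nlinarith
  have h4 : stopTime x P v κ = sInf {t | t ∈ Set.Icc (0 : ℝ) n ∧ R t - n * κ ≤ 0} := by
    unfold stopTime
    congr 1
    ext t
    refine and_congr_right fun ht => ?_
    rw [h.flow_eq hn ht.1 ht.2, empNorm_sq, div_le_iff₀ hn0, sub_nonpos, mul_comm κ]
  obtain ⟨h5, h6, h7, h8⟩ := firstPassage h1 h2 hn0.le h3 h4
  refine ⟨h5, sub_nonpos.1 h6, fun h0 => sub_eq_zero.1 (h7 h0), fun a ha => ?_⟩
  rw [h8 a ha, sub_nonpos]

lemma balancedOracle_spec (h : IsGrownTree rule x y P) (hn : 1 ≤ n) (F e : Fin n → ℝ) :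
    let A := fun t => (F - spec (fun g => avg (rel x (P g))) (fun g => (P g).ncard) t F) ⬝ᵥ
      (F - spec (fun g => avg (rel x (P g))) (fun g => (P g).ncard) t F)
    let S := fun t => spec (fun g => avg (rel x (P g))) (fun g => (P g).ncard) t e ⬝ᵥ
      spec (fun g => avg (rel x (P g))) (fun g => (P g).ncard) t e
    balancedOracle x P F e ∈ Set.Icc (0 : ℝ) n ∧
      A (balancedOracle x P F e) = S (balancedOracle x P F e) ∧
      ∀ a, 0 ≤ a → (balancedOracle x P F e ≤ a ↔ A a ≤ S a) := by
  intro A S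
  have hc := h.isChain hn
  have hn0 : (0 : ℝ) < n := by exact_mod_cast hn
  have h1 : Continuous fun t => A t - S t :=
    (hc.continuous_sub_spec_dot F).sub (hc.continuous_spec_dot e)
  have h2 : Antitone fun t => A t - S t := fun s t hst =>
    sub_le_sub (hc.sub_spec_dot_anti F hst) (hc.spec_dot_mono e hst)
  have h3 : A n - S n ≤ 0 := by
    simp only [A, S, hc.spec_last hn, sub_self, dotProduct_zero]
    linarith [dot_self_nonneg e]
  have h4 : balancedOracle x P F e = sInf {t | t ∈ Set.Icc (0 : ℝ) n ∧ A t - S t ≤ 0} := by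
    unfold balancedOracle
    congr 1
    ext t
    refine and_congr_right fun ht => ?_
    rw [h.flow_eq hn ht.1 ht.2, h.flow_eq hn ht.1 ht.2, empNorm_le_iff hn, sub_nonpos]
  obtain ⟨h5, h6, h7, h8⟩ := firstPassage h1 h2 hn0.le h3 h4
  refine ⟨h5, ?_, fun a ha => ?_⟩
  · rcases h5.1.lt_or_eq with h0 | h0
    · exact sub_eq_zero.1 (h7 h0)
    -- At time 0 the noise term is 0, so balance is again an equality.
    · refine le_antisymm (sub_nonpos.1 h6) ?_
      rw [← h0]
      simp only [S, hc.spec_zero, dotProduct_zero]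
      exact dot_self_nonneg _
  · rw [h8 a ha, sub_nonpos]

lemma oracleError_eq (h : IsGrownTree rule x y P) (hn : 1 ≤ n) (F e : Fin n → ℝ) :
    oracleError x P F e = ⨅ t : Set.Icc (0 : ℝ) n,
      (empNorm (F - spec (fun g => avg (rel x (P g))) (fun g => (P g).ncard) t F) ^ 2 +
        empNorm (spec (fun g => avg (rel x (P g))) (fun g => (P g).ncard) t e) ^ 2) := by
  unfold oracleError
  congr 1
  funext t
  rw [h.flow_eq hn t.2.1 t.2.2, h.flow_eq hn t.2.1 t.2.2]

lemma oracleError_nonneg (F e : Fin n → ℝ) : 0 ≤ oracleError x P F e :=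
  Real.iInf_nonneg fun t => by positivity

lemma oracleError_le (h : IsGrownTree rule x y P) (hn : 1 ≤ n) (F e : Fin n → ℝ) :
    oracleError x P F e ≤ empNorm e ^ 2 := by
  have hc := h.isChain hn
  rw [h.oracleError_eq hn]
  have hbdd : BddBelow (Set.range fun t : Set.Icc (0 : ℝ) n =>
      empNorm (F - spec (fun g => avg (rel x (P g))) (fun g => (P g).ncard) t F) ^ 2 +
        empNorm (spec (fun g => avg (rel x (P g))) (fun g => (P g).ncard) t e) ^ 2) := by
    refine ⟨0, ?_⟩
    rintro _ ⟨t, rfl⟩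
    positivity
  refine (ciInf_le hbdd ⟨n, Nat.cast_nonneg n, le_rfl⟩).trans (le_of_eq ?_)
  simp [hc.spec_last hn, empNorm_sq]

/-- Before the balanced time the bias, and after it the stochastic error, is at least the common
value. -/
lemma balanced_le_oracleError (h : IsGrownTree rule x y P) (hn : 1 ≤ n) (F e : Fin n → ℝ) :
    (spec (fun g => avg (rel x (P g))) (fun g => (P g).ncard) (balancedOracle x P F e) e ⬝ᵥ
      spec (fun g => avg (rel x (P g))) (fun g => (P g).ncard) (balancedOracle x P F e) e) / n ≤
      oracleError x P F e := by
  have hc := h.isChain hn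
  obtain ⟨-, h2, -⟩ := h.balancedOracle_spec hn F e
  rw [h.oracleError_eq hn]
  have : Nonempty (Set.Icc (0 : ℝ) n) := ⟨⟨0, le_rfl, Nat.cast_nonneg n⟩⟩
  refine le_ciInf fun t => ?_
  rw [empNorm_sq, empNorm_sq, ← add_div]
  have e1 := dot_self_nonneg (F - spec (fun g => avg (rel x (P g))) (fun g => (P g).ncard) t F)
  have e2 := dot_self_nonneg (spec (fun g => avg (rel x (P g))) (fun g => (P g).ncard) t e)
  gcongr
  rcases le_total (t : ℝ) (balancedOracle x P F e) with ht | ht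
  · have := hc.sub_spec_dot_anti F ht
    simp only at this h2
    linarith
  · have := hc.spec_dot_mono e ht
    simp only at this
    linarith

/-- The pathwise error bound for the stopped estimator. -/
lemma error_le (h : IsGrownTree rule x y P) (hn : 1 ≤ n) {s L κ : ℝ} (hs : 0 < s) (hL : 0 ≤ L)
    (hκ : 0 ≤ κ) (F e : Fin n → ℝ) :
    empNorm (stoppedFit x P (F + e) κ - F) ^ 2 ≤ 9 * oracleError x P F e +
      2 * |κ - empNorm e ^ 2| + 24 * (s ^ 2 * L / n) * balancedOracle x P F e +
        6 * (s ^ 2 / n) * devSum s L x F e := by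
  have hc := h.isChain hn
  have hn0 : (0 : ℝ) < n := by exact_mod_cast hn
  obtain ⟨hτ, hτ1, hτ2, -⟩ := h.stopTime_spec hn (F + e) hκ
  obtain ⟨hb, hb1, -⟩ := h.balancedOracle_spec hn F e
  have hdev := devSum_nonneg s L x F e
  have key := hc.loss_le hn F e hτ1 hτ2 hb.1 hb.2 hb1 (a := 6 * L * s ^ 2)
    (c := 2 * s ^ 2 * devSum s L x F e) (by positivity) (by positivity)
    (fun g _ => h.extProj_le hn hs L F e g)
  have ho := h.balanced_le_oracleError hn F e
  rw [div_le_iff₀ hn0] at ho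
  have habs : |n * κ - e ⬝ᵥ e| = n * |κ - empNorm e ^ 2| := by
    rw [empNorm_sq, ← abs_of_pos hn0, ← abs_mul, abs_of_pos hn0, mul_sub,
      mul_div_cancel₀ _ hn0.ne']
  rw [habs] at key
  rw [empNorm_sq, stoppedFit, h.flow_eq hn hτ.1 hτ.2, div_le_iff₀ hn0]
  have e1 : (9 * oracleError x P F e + 2 * |κ - empNorm e ^ 2| +
      24 * (s ^ 2 * L / n) * balancedOracle x P F e +
        6 * (s ^ 2 / n) * devSum s L x F e) * n = 9 * (oracleError x P F e * n) +
      2 * (n * |κ - empNorm e ^ 2|) + 4 * (6 * L * s ^ 2) * balancedOracle x P F e +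
        3 * (2 * s ^ 2 * devSum s L x F e) := by
    field_simp
    ring
  rw [e1]
  linarith

end IsGrownTree

/-! ### Measurability of the stopped estimator -/

/-- Only the relations "same node" are assumed measurable, so the node count has to be recovered
from them. -/
lemma Reach.card_classes {n d : ℕ} {x : Fin n → Fin d → ℝ} {m : ℕ} {P : Set (Set (Fin d → ℝ))}
    (h : Reach x m P) (hn : 1 ≤ n) : (classes (rel x P)).card = P.ncard := by
  classical
  have hcls : ∀ A ∈ P, ∀ i, x i ∈ A → cls (rel x P) i = nodeIdx x A := by
    intro A hA i hi
    ext i'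
    rw [mem_cls, mem_nodeIdx, h.rel_iff hA hi]
  have himg : classes (rel x P) = h.finite_ncard.1.toFinset.image (nodeIdx x) := by
    ext b
    simp only [classes, Finset.mem_image, Finset.mem_univ, true_and, Set.Finite.mem_toFinset]
    constructor
    · rintro ⟨i, rfl⟩
      obtain ⟨A, hA, hi⟩ := h.exists_mem (x i)
      exact ⟨A, hA, (hcls A hA i hi).symm⟩
    · rintro ⟨A, hA, rfl⟩
      obtain ⟨i, hi⟩ := one_le_nodeSize.1 (h.one_le_size hn A hA)
      exact ⟨i, hcls A hA i hi⟩
  rw [himg, Finset.card_image_of_injOn, ← Set.ncard_eq_toFinset_card P h.finite_ncard.1]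
  intro A hA B hB hAB
  simp only [Set.Finite.coe_toFinset] at hA hB
  obtain ⟨i, hi⟩ := one_le_nodeSize.1 (h.one_le_size hn A hA)
  have : i ∈ nodeIdx x B := hAB ▸ mem_nodeIdx.2 hi
  exact h.eq_of_mem A hA B hB _ hi (mem_nodeIdx.1 this)

/-- The number of nodes of the `g`-th partition, read off from the induced relations. -/
noncomputable def numClasses {n : ℕ} (r : ℕ → Fin n → Fin n → Prop) (g : ℕ) : ℕ :=
  if g = 0 then 0 else (classes (r g)).card

lemma IsGrownTree.numClasses_eq {n d : ℕ} {x : Fin n → Fin d → ℝ} {y : Fin n → ℝ}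
    {P : ℕ → Set (Set (Fin d → ℝ))} {rule : GrowthRule} (h : IsGrownTree rule x y P)
    (hn : 1 ≤ n) : numClasses (fun g => rel x (P g)) = fun g => (P g).ncard := by
  funext g
  rcases g with _ | g
  · simp [numClasses, h.1]
  · obtain ⟨m, hm⟩ := h.exists_reach hn g
    simp [numClasses, hm.card_classes hn]

/-- The interpolated projections in terms of the relations induced by the partitions. -/
noncomputable def relFlow {n : ℕ} (r : ℕ → Fin n → Fin n → Prop) (t : ℝ) (v : Fin n → ℝ) :
    Fin n → ℝ := spec (fun g => avg (r g)) (numClasses r) t v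

lemma IsGrownTree.spec_eq {n d : ℕ} {x : Fin n → Fin d → ℝ} {y : Fin n → ℝ}
    {P : ℕ → Set (Set (Fin d → ℝ))} {rule : GrowthRule} (h : IsGrownTree rule x y P)
    (hn : 1 ≤ n) (t : ℝ) (v : Fin n → ℝ) :
    spec (fun g => avg (rel x (P g))) (fun g => (P g).ncard) t v =
      relFlow (fun g => rel x (P g)) t v := by
  rw [relFlow, h.numClasses_eq hn]

section Measurability

variable {Ω : Type*} [MeasurableSpace Ω] {n : ℕ}

lemma measurable_numClasses {r : Ω → ℕ → Fin n → Fin n → Prop}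
    (hr : ∀ g i i', MeasurableSet {ω | r ω g i i'}) (g : ℕ) :
    Measurable fun ω => numClasses (r ω) g := by
  have h1 : Measurable fun ω => r ω g :=
    measurable_pi_iff.2 fun i => measurable_pi_iff.2 fun i' => measurableSet_setOfPred.1 (hr g i i')
  unfold numClasses
  split_ifs
  · exact measurable_const
  · exact (measurable_of_countable fun q : Fin n → Fin n → Prop => (classes q).card).comp h1

lemma measurable_relFlow {r : Ω → ℕ → Fin n → Fin n → Prop}
    (hr : ∀ g i i', MeasurableSet {ω | r ω g i i'}) {t : Ω → ℝ} (ht : Measurable t)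
    {v : Ω → Fin n → ℝ} (hv : Measurable v) : Measurable fun ω => relFlow (r ω) (t ω) (v ω) := by
  unfold relFlow spec comb incr wt
  refine Finset.measurable_sum _ fun g _ => ?_
  have hk : ∀ g, Measurable fun ω => (numClasses (r ω) g : ℝ) := fun g =>
    measurable_from_top.comp (measurable_numClasses hr g)
  have h1 := measurable_avg (hr (g + 1)) hv
  have h2 := measurable_avg (hr g) hv
  have h3 : Measurable fun ω => max 0 (min 1 ((t ω - numClasses (r ω) g) /
      ((numClasses (r ω) (g + 1) : ℝ) - numClasses (r ω) g))) :=
    measurable_const.max (measurable_const.min ((ht.sub (hk g)).div ((hk (g + 1)).sub (hk g))))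
  exact h3.smul (h1.sub h2)

/-- The description of `f` holds only almost surely, so `f` is set to 0 off a measurable set of full
measure. -/
lemma aemeasurable_of_ae_le_iff {μ : Measure Ω} {f : Ω → ℝ} {S : ℝ → Set Ω}
    (hS : ∀ a, 0 ≤ a → MeasurableSet (S a))
    (h : ∀ᵐ ω ∂μ, 0 ≤ f ω ∧ ∀ a, 0 ≤ a → (f ω ≤ a ↔ ω ∈ S a)) : AEMeasurable f μ := by
  obtain ⟨G, hG, hGm, hGp⟩ := h.exists_measurable_mem
  refine ⟨G.indicator f, measurable_of_Iic fun a => ?_, ?_⟩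
  · rcases lt_or_ge a 0 with ha | ha
    · convert MeasurableSet.empty (α := Ω) using 1
      refine Set.eq_empty_iff_forall_notMem.2 fun ω hω => ?_
      have h1 : G.indicator f ω ≤ a := hω
      have h2 : 0 ≤ G.indicator f ω := Set.indicator_nonneg (fun ω hω => (hGp ω hω).1) ω
      linarith
    · convert (hGm.inter (hS a ha)).union hGm.compl using 1
      ext ω
      by_cases hω : ω ∈ G
      · simp [hω, (hGp ω hω).2 a ha]
      · simp [hω, ha]
  · filter_upwards [hG] with ω hω
    rw [Set.indicator_of_mem hω]

end Measurability

/-! ### Integrability and the oracle inequality -/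

lemma integrable_empNorm_sq {Ω : Type*} [MeasurableSpace Ω] {μ : Measure Ω} {n d : ℕ}
    (hn : 1 ≤ n) {X : Ω → Fin n → Fin d → ℝ} {ε : Ω → Fin n → ℝ} (hε : Measurable ε) {s : ℝ}
    (hsub : SubgaussianNoise μ X ε s) : Integrable (fun ω => empNorm (ε ω) ^ 2) μ := by
  have hn0 : (n : ℝ) ≠ 0 := by positivity
  simp only [empNorm_sq]
  refine Integrable.div_const ?_ _
  unfold dotProduct
  refine integrable_finsetSum _ fun i _ => ?_
  have e1 : ∀ (c : ℝ) (e : Fin n → ℝ), empInner (Pi.single i (c * n)) e = c * e i := by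
    intro c e
    rw [empInner, Finset.sum_eq_single i]
    · rw [Pi.single_eq_same]
      field_simp
    · intro j _ hj
      rw [Pi.single_eq_of_ne hj, zero_mul]
    · simp
  have hp := (hsub (Pi.single i (1 * n))).1
  have hm := (hsub (Pi.single i (-1 * n))).1
  simp only [e1] at hp hm
  have hi : Measurable fun ω => ε ω i := (measurable_pi_apply i).comp hε
  -- The majorant comes from `x²/2 ≤ exp|x| ≤ exp(x) + exp(-x)`, with the moment hypothesis applied
  -- to `±n` times a coordinate vector.
  refine ((hp.add hm).const_mul 2).mono' (hi.mul hi).aestronglyMeasurable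
    (Filter.Eventually.of_forall fun ω => ?_)
  rw [Real.norm_of_nonneg (mul_self_nonneg _)]
  have h1 := Real.quadratic_le_exp_of_nonneg (abs_nonneg (ε ω i))
  have h2 : Real.exp |ε ω i| ≤ Real.exp (1 * ε ω i) + Real.exp (-1 * ε ω i) := by
    have := Real.exp_pos (1 * ε ω i)
    have := Real.exp_pos (-1 * ε ω i)
    rcases abs_cases (ε ω i) with ⟨h, -⟩ | ⟨h, -⟩ <;> rw [h]
    · rw [one_mul] at *
      linarith
    · rw [neg_one_mul] at *
      linarith
  have h3 := sq_abs (ε ω i)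
  have h4 := abs_nonneg (ε ω i)
  simp only [Pi.add_apply]
  nlinarith

lemma SubgaussianNoise.mono {Ω : Type*} [MeasurableSpace Ω] {μ : Measure Ω} {n d : ℕ}
    {X : Ω → Fin n → Fin d → ℝ} {ε : Ω → Fin n → ℝ} {s s' : ℝ} (hs : 0 ≤ s) (hss : s ≤ s')
    (hsub : SubgaussianNoise μ X ε s) : SubgaussianNoise μ X ε s' := by
  intro l
  refine ⟨(hsub l).1, ?_⟩
  filter_upwards [(hsub l).2] with ω hω
  refine hω.trans (Real.exp_le_exp.2 ?_)
  gcongr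

set_option maxHeartbeats 400000 in
/-- Integrability of the loss and the oracle inequality for a positive
subgaussian constant. -/
lemma oracle_inequality {Ω : Type*} [MeasurableSpace Ω] {μ : Measure Ω} [IsProbabilityMeasure μ]
    {n d : ℕ} (hn : 1 ≤ n) {rule : GrowthRule}
    {X : Ω → Fin n → Fin d → ℝ} (hX : Measurable X)
    {f : (Fin d → ℝ) → ℝ} (hf : Measurable f)
    {ε : Ω → Fin n → ℝ} (hε : Measurable ε)
    {s : ℝ} (hs : 0 < s) (hsub : SubgaussianNoise μ X ε s)
    {F Y : Ω → Fin n → ℝ} (hF : ∀ ω i, F ω i = f (X ω i)) (hY : ∀ ω i, Y ω i = F ω i + ε ω i)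
    {P : Ω → ℕ → Set (Set (Fin d → ℝ))}
    (hPmeas : ∀ g i i', MeasurableSet {ω | SameNode (P ω g) (X ω i) (X ω i')})
    (hP : ∀ᵐ ω ∂μ, IsGrownTree rule (X ω) (Y ω) (P ω))
    {κ : Ω → ℝ} (hκ : Integrable κ μ) (hκ0 : ∀ ω, 0 ≤ κ ω) :
    Integrable (fun ω => empNorm (stoppedFit (X ω) (P ω) (Y ω) (κ ω) - F ω) ^ 2) μ ∧
    ∫ ω, empNorm (stoppedFit (X ω) (P ω) (Y ω) (κ ω) - F ω) ^ 2 ∂μ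
      ≤ 9 * ∫ ω, oracleError (X ω) (P ω) (F ω) (ε ω) ∂μ
        + 2 * ∫ ω, |κ ω - empNorm (ε ω) ^ 2| ∂μ
        + 24 * (s ^ 2 * Real.log (max (d : ℝ) 2 * n) / n)
          * ∫ ω, (balancedOracle (X ω) (P ω) (F ω) (ε ω) + 1) ∂μ := by
  have hn0 : (0 : ℝ) < n := by exact_mod_cast hn
  have hn1 : (1 : ℝ) ≤ n := by exact_mod_cast hn
  set L := Real.log (max (d : ℝ) 2 * n) with hLdef
  have hL : 0 ≤ L := by
    refine Real.log_nonneg ?_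
    have : (2 : ℝ) ≤ max (d : ℝ) 2 := le_max_right _ _
    nlinarith
  have hFX : ∀ ω, F ω = fun i => f (X ω i) := fun ω => funext (hF ω)
  have hv : Measurable fun (x : Fin n → Fin d → ℝ) (i : Fin n) => f (x i) :=
    measurable_pi_iff.2 fun i => hf.comp (measurable_pi_apply i)
  have hFm : Measurable F := by
    rw [show F = fun ω i => f (X ω i) from funext hFX]
    exact hv.comp hX
  have hYe : ∀ ω, Y ω = F ω + ε ω := fun ω => funext (hY ω)
  have hYm : Measurable Y := by
    rw [show Y = fun ω => F ω + ε ω from funext hYe]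
    exact hFm.add hε
  have hflow : ∀ {t : Ω → ℝ} {v : Ω → Fin n → ℝ}, Measurable t → Measurable v →
      Measurable fun ω => relFlow (fun g => rel (X ω) (P ω g)) (t ω) (v ω) := fun ht hv =>
    measurable_relFlow (r := fun ω g => rel (X ω) (P ω g)) hPmeas ht hv
  have hres : ∀ (a : ℝ) {v : Ω → Fin n → ℝ}, Measurable v → Measurable fun ω =>
      (v ω - relFlow (fun g => rel (X ω) (P ω g)) a (v ω)) ⬝ᵥ
        (v ω - relFlow (fun g => rel (X ω) (P ω g)) a (v ω)) := fun a v hv =>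
    measurable_dot (hv.sub (hflow measurable_const hv)) (hv.sub (hflow measurable_const hv))
  have hsq : ∀ (a : ℝ) {v : Ω → Fin n → ℝ}, Measurable v → Measurable fun ω =>
      relFlow (fun g => rel (X ω) (P ω g)) a (v ω) ⬝ᵥ
        relFlow (fun g => rel (X ω) (P ω g)) a (v ω) := fun a v hv =>
    measurable_dot (hflow measurable_const hv) (hflow measurable_const hv)
  -- measurability of the random times
  obtain ⟨κ', hκ'm, hκκ'⟩ := hκ.aestronglyMeasurable.aemeasurable
  have hτ : AEMeasurable (fun ω => stopTime (X ω) (P ω) (Y ω) (κ ω)) μ := by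
    refine aemeasurable_of_ae_le_iff (S := fun a => {ω |
      (Y ω - relFlow (fun g => rel (X ω) (P ω g)) a (Y ω)) ⬝ᵥ
        (Y ω - relFlow (fun g => rel (X ω) (P ω g)) a (Y ω)) ≤ n * κ' ω})
      (fun a _ => measurableSet_le (hres a hYm) (measurable_const.mul hκ'm)) ?_
    filter_upwards [hP, hκκ'] with ω hω hκω
    obtain ⟨h1, -, -, h4⟩ := hω.stopTime_spec hn (Y ω) (hκ0 ω)
    simp only [hω.spec_eq hn, hκω] at h4
    rw [hκω]
    exact ⟨by rw [← hκω]; exact h1.1, h4⟩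
  have hb : AEMeasurable (fun ω => balancedOracle (X ω) (P ω) (F ω) (ε ω)) μ := by
    refine aemeasurable_of_ae_le_iff (S := fun a => {ω |
      (F ω - relFlow (fun g => rel (X ω) (P ω g)) a (F ω)) ⬝ᵥ
        (F ω - relFlow (fun g => rel (X ω) (P ω g)) a (F ω)) ≤
      relFlow (fun g => rel (X ω) (P ω g)) a (ε ω) ⬝ᵥ
        relFlow (fun g => rel (X ω) (P ω g)) a (ε ω)})
      (fun a _ => measurableSet_le (hres a hFm) (hsq a hε)) ?_
    filter_upwards [hP] with ω hω
    obtain ⟨h1, -, h4⟩ := hω.balancedOracle_spec hn (F ω) (ε ω)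
    simp only [hω.spec_eq hn] at h4
    exact ⟨h1.1, h4⟩
  have hb_int : Integrable (fun ω => balancedOracle (X ω) (P ω) (F ω) (ε ω)) μ := by
    refine (integrable_const (n : ℝ)).mono' hb.aestronglyMeasurable ?_
    filter_upwards [hP] with ω hω
    obtain ⟨h1, -, -⟩ := hω.balancedOracle_spec hn (F ω) (ε ω)
    rw [Real.norm_of_nonneg h1.1]
    exact h1.2
  -- the oracle error
  have hO : AEMeasurable (fun ω => oracleError (X ω) (P ω) (F ω) (ε ω)) μ := by
    -- By continuity in `t` the infimum may be taken over a countable dense set of times.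
    obtain ⟨D, hDc, hDd⟩ := TopologicalSpace.exists_countable_dense (Set.Icc (0 : ℝ) n)
    have := hDc.to_subtype
    refine ⟨fun ω => ⨅ t : D,
      (empNorm (F ω - relFlow (fun g => rel (X ω) (P ω g)) t (F ω)) ^ 2 +
        empNorm (relFlow (fun g => rel (X ω) (P ω g)) t (ε ω)) ^ 2),
      Measurable.iInf fun t => ?_, ?_⟩
    · simp only [empNorm_sq]
      exact ((hres _ hFm).div_const _).add ((hsq _ hε).div_const _)
    · filter_upwards [hP] with ω hω
      have hcont := ((hω.isChain hn).continuous_oracle (F ω) (ε ω)).comp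
        (continuous_subtype_val (p := fun t => t ∈ Set.Icc (0 : ℝ) n))
      simp only [Function.comp_def, hω.spec_eq hn] at hcont
      rw [hω.oracleError_eq hn]
      simp only [hω.spec_eq hn]
      exact (hDd.ciInf' hcont).symm
  have hε_int := integrable_empNorm_sq hn hε hsub
  have hO_int : Integrable (fun ω => oracleError (X ω) (P ω) (F ω) (ε ω)) μ := by
    refine hε_int.mono' hO.aestronglyMeasurable ?_
    filter_upwards [hP] with ω hω
    rw [Real.norm_of_nonneg (IsGrownTree.oracleError_nonneg _ _)]
    exact hω.oracleError_le hn (F ω) (ε ω)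
  have hκε_int : Integrable (fun ω => |κ ω - empNorm (ε ω) ^ 2|) μ := (hκ.sub hε_int).abs
  -- the deviation term
  have hdevm : Measurable fun ω => devSum s L (X ω) (F ω) (ε ω) := by
    have h1 := (measurable_devSum (v := fun (x : Fin n → Fin d → ℝ) i => f (x i)) s L hv).comp
      (hX.prodMk hε)
    simpa only [hFX, Function.comp_def] using h1
  have hdev_le : ∫⁻ ω, ENNReal.ofReal (devSum s L (X ω) (F ω) (ε ω)) ∂μ ≤
      ENNReal.ofReal (4 * L) := by
    have h1 := lintegral_devSum_le (v := fun (x : Fin n → Fin d → ℝ) i => f (x i)) hn hX hε hs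
      hsub hv
    simpa only [hFX] using h1
  have hdev_nonneg : 0 ≤ᵐ[μ] fun ω => devSum s L (X ω) (F ω) (ε ω) :=
    Filter.Eventually.of_forall fun ω => devSum_nonneg _ _ _ _ _
  have hdev_int : Integrable (fun ω => devSum s L (X ω) (F ω) (ε ω)) μ :=
    ⟨hdevm.aestronglyMeasurable, (hasFiniteIntegral_iff_ofReal hdev_nonneg).2
      (hdev_le.trans_lt ENNReal.ofReal_lt_top)⟩
  have hdev_int_le : ∫ ω, devSum s L (X ω) (F ω) (ε ω) ∂μ ≤ 4 * L := by
    rw [integral_eq_lintegral_of_nonneg_ae hdev_nonneg hdevm.aestronglyMeasurable]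
    exact ENNReal.toReal_le_of_le_ofReal (by positivity) hdev_le
  -- the loss
  have hloss : AEStronglyMeasurable
      (fun ω => empNorm (stoppedFit (X ω) (P ω) (Y ω) (κ ω) - F ω) ^ 2) μ := by
    obtain ⟨τ, hτm, hττ⟩ := hτ
    refine AEMeasurable.aestronglyMeasurable
      ⟨fun ω => empNorm (relFlow (fun g => rel (X ω) (P ω g)) (τ ω) (Y ω) - F ω) ^ 2, ?_, ?_⟩
    · simp only [empNorm_sq]
      exact (measurable_dot ((hflow hτm hYm).sub hFm) ((hflow hτm hYm).sub hFm)).div_const _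
    · filter_upwards [hP, hττ] with ω hω hτω
      obtain ⟨h1, -⟩ := hω.stopTime_spec hn (Y ω) (hκ0 ω)
      rw [stoppedFit, hω.flow_eq hn h1.1 h1.2, hω.spec_eq hn, hτω]
  have hbound : ∀ᵐ ω ∂μ, empNorm (stoppedFit (X ω) (P ω) (Y ω) (κ ω) - F ω) ^ 2 ≤
      9 * oracleError (X ω) (P ω) (F ω) (ε ω) + 2 * |κ ω - empNorm (ε ω) ^ 2| +
      24 * (s ^ 2 * L / n) * balancedOracle (X ω) (P ω) (F ω) (ε ω) +
        6 * (s ^ 2 / n) * devSum s L (X ω) (F ω) (ε ω) := by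
    filter_upwards [hP] with ω hω
    rw [hYe ω]
    exact hω.error_le hn hs hL (hκ0 ω) (F ω) (ε ω)
  have i1 := hO_int.const_mul 9
  have i2 := hκε_int.const_mul 2
  have i3 := hb_int.const_mul (24 * (s ^ 2 * L / n))
  have i4 := hdev_int.const_mul (6 * (s ^ 2 / n))
  have i12 := i1.add i2
  have i123 := i12.add i3
  have i1234 := i123.add i4
  have hint : Integrable (fun ω => empNorm (stoppedFit (X ω) (P ω) (Y ω) (κ ω) - F ω) ^ 2) μ := by
    refine i1234.mono' hloss ?_
    filter_upwards [hbound] with ω hω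
    rw [Real.norm_of_nonneg (sq_nonneg _)]
    exact hω
  refine ⟨hint, (integral_mono_ae hint i1234 hbound).trans ?_⟩
  rw [integral_add' i123 i4, integral_add' i12 i3, integral_add' i1 i2, integral_const_mul,
    integral_const_mul, integral_const_mul, integral_const_mul,
    integral_add hb_int (integrable_const _)]
  have h1 : 6 * (s ^ 2 / n) * ∫ ω, devSum s L (X ω) (F ω) (ε ω) ∂μ ≤
      6 * (s ^ 2 / n) * (4 * L) := mul_le_mul_of_nonneg_left hdev_int_le (by positivity)
  -- The mean of the deviation term is exactly the `+ 1` next to the balanced time.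
  have h2 : 6 * (s ^ 2 / n) * (4 * L) = 24 * (s ^ 2 * L / n) := by ring
  have h3 : ∫ _, (1 : ℝ) ∂μ = 1 := by simp
  rw [h3]
  linarith

end TreeStopping

theorem mainTheorem1 {Ω : Type*} [MeasurableSpace Ω] (μ : Measure Ω) [IsProbabilityMeasure μ]
    {n d : ℕ} (hn : 1 ≤ n) (rule : TreeStopping.GrowthRule)
    (X : Ω → Fin n → Fin d → ℝ) (hX : Measurable X)
    (hdistinct : ∀ᵐ ω ∂μ, Function.Injective (X ω))
    (f : (Fin d → ℝ) → ℝ) (hf : Measurable f)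
    (ε : Ω → Fin n → ℝ) (hε : Measurable ε)
    (s : ℝ) (hs : 0 ≤ s) (hsub : TreeStopping.SubgaussianNoise μ X ε s)
    (F Y : Ω → Fin n → ℝ) (hF : ∀ ω i, F ω i = f (X ω i)) (hY : ∀ ω i, Y ω i = F ω i + ε ω i)
    (P : Ω → ℕ → Set (Set (Fin d → ℝ)))
    (hPmeas : ∀ g i i', MeasurableSet {ω | TreeStopping.SameNode (P ω g) (X ω i) (X ω i')})
    (hP : ∀ᵐ ω ∂μ, TreeStopping.IsGrownTree rule (X ω) (Y ω) (P ω))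
    (κ : Ω → ℝ) (hκ : Integrable κ μ) (hκ0 : ∀ ω, 0 ≤ κ ω) :
    Integrable (fun ω => TreeStopping.empNorm
      (TreeStopping.stoppedFit (X ω) (P ω) (Y ω) (κ ω) - F ω) ^ 2) μ ∧
    ∫ ω, TreeStopping.empNorm
        (TreeStopping.stoppedFit (X ω) (P ω) (Y ω) (κ ω) - F ω) ^ 2 ∂μ
      ≤ 9 * ∫ ω, TreeStopping.oracleError (X ω) (P ω) (F ω) (ε ω) ∂μ
        + 2 * ∫ ω, |κ ω - TreeStopping.empNorm (ε ω) ^ 2| ∂μ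
        + 24 * (s ^ 2 * Real.log (max (d : ℝ) 2 * n) / n)
          * ∫ ω, (TreeStopping.balancedOracle (X ω) (P ω) (F ω) (ε ω) + 1) ∂μ := by
  have main : ∀ s' : ℝ, 0 < s' → s ≤ s' → _ := fun s' h0 hss =>
    TreeStopping.oracle_inequality hn hX hf hε h0 (hsub.mono hs hss) hF hY hPmeas hP hκ hκ0
  refine ⟨(main (s + 1) (by linarith) (by linarith)).1, ?_⟩
  have hcont : Continuous fun s' : ℝ =>
      9 * ∫ ω, TreeStopping.oracleError (X ω) (P ω) (F ω) (ε ω) ∂μ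
        + 2 * ∫ ω, |κ ω - TreeStopping.empNorm (ε ω) ^ 2| ∂μ
        + 24 * (s' ^ 2 * Real.log (max (d : ℝ) 2 * n) / n)
          * ∫ ω, (TreeStopping.balancedOracle (X ω) (P ω) (F ω) (ε ω) + 1) ∂μ := by
    fun_prop
  -- The right side is continuous in the subgaussian constant and the left side does not involve it,
  -- so `s' ↓ s` covers `s = 0`.
  refine ge_of_tendsto (hcont.continuousAt.tendsto.mono_left
    (nhdsWithin_le_nhds (s := Set.Ioi s))) ?_
  filter_upwards [self_mem_nhdsWithin] with s' hs'
  have hlt : s < s' := hs'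
  exact (main s' (hs.trans_lt hlt) hlt.le).2
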